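/- Let $(\mathcal A_i,\varphi_i)_{i\in I}$ be noncommutative probability spaces: each $\mathcal A_i$ is a unital algebra over $\mathbb C$ with unit $1_i$, and $\varphi_i:\mathcal A_i\to\mathbb C$ is linear with $\varphi_i(1_i)=1$. Let $\varphi_{i,t}=\varphi_i+t\varphi_i'+o(t)$, $t\in(-\epsilon,\epsilon)$, be normalized linear functionals on $\mathcal A_i$ (the expansion holds on each element of $\mathcal A_i$), where $\varphi_i'$ is linear and $\varphi_i'(1_i)=0$. Let $\star_{i}\mathcal A_i$ and $*_{i}\mathcal A_i$ be the free products with and without identification of units, $\tau:*_i\mathcal A_i\to\star_i\mathcal A_i$ the unit identification map, $\varphi=(\star_i\varphi_i)\circ\tau$ and $\varphi_t=(\star_i\varphi_{i,t})\circ\tau$, where $\star_i\psi_i$ denotes the free product of normalized functionals (the unique normalized functional that restricts to each $\psi_i$ and vanishes on alternating products of centered elements). *Motzkin functionals.* A reduced Motzkin word of length $n\ge1$ is $w=j_1\cdots j_n$ with $j_k\in\{1,2,\dots\}$, $j_1=j_n=1$ and $j_{k+1}-j_k\in\{-1,0,1\}$; $\mathcal M_n$ is the set of these words. Let $\widetilde{\mathcal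 A}_i=\mathcal A_i\star\mathrm{alg}(p_i)$ with $p_i^2=p_i$, and let $\widetilde\varphi_{i,t}$ be the functional on it with $\widetilde\varphi_{i,t}(p_i^{\alpha}a_1p_ia_2p_i\cdots p_ia_np_i^{\beta})=\varphi_{i,t}(a_1)\cdots\varphi_{i,t}(a_n)$ for $\alpha,\beta\in\{0,1\}$. On the tensor product of copies of $\widetilde{\mathcal A}_i$ over all sites $(i,j)$, $i\in I$, $j\ge1$, let $\Phi_t$ be the tensor product of the functionals $\widetilde\varphi_{i,t}$. For $a\in\mathcal A_i$ and $j\ge 1$ let $a(j)=a_{i,j}\,(P_{i,j}-P_{i,j-1})$, where $a_{i,j}$ is $a$ placed at site $(i,j)$ with units elsewhere, $P_{i,j}$ has $p_{i'}$ at all sites $(i',j')$ with $i'\ne i$, $j'\ge j$ and units elsewhere, and $P_{i,0}=0$. Put $$\Phi_{w,t}(a_1,\dots,a_n)=\Phi_t(a_1(j_1)\cdots a_n(j_n)),\qquad \Phi_w'(a_1,\dots,a_n)=\tfrac{d}{dt}\Big|_{t=0}\Phi_{w,t}(a_1,\dots,a_n).$$ **Theorem 7.1.** The derivative $\varphi'(x)=\frac{d}{dt}\big|_{t=0}\varphi_t(x)$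 exists for every $x\in *_i\mathcal A_i$. Let $n\ge1$, $a_1\in\mathcal A_{i_1},\dots,a_n\in\mathcal A_{i_n}$ with $i_1\neq i_2\neq\cdots\neq i_n$ (neighboring labels differ). 1. All the derivatives $\Phi'_w(a_1,\dots,a_n)$, $w\in\mathcal M_n$, exist, and $$\varphi'(a_1\cdots a_n)=\sum_{w\in\mathcal M_n}\Phi_w'(a_1,\dots,a_n).$$ 2. If moreover $\varphi_{i_k}(a_k)=0$ for all $k$, then $$\varphi'(a_1\cdots a_n)=\varphi_{i_m}'(a_m)\prod_{k=1}^{m-1}\varphi_{i_k}(a_ka_{n+1-k})$$ whenever $n=2m-1$ is odd and $i_k=i_{n+1-k}$ for all $k$, and $\varphi'(a_1\cdots a_n)=0$ otherwise. 3. In particular the characteristic formula for infinitesimal freeness holds for $(\varphi,\varphi')$: for $a_1,\dots,a_n$ as in 2, $\varphi(a_1\cdots a_n)=0$, and $\varphi'(a_1\cdots a_n)=\varphi'(a_m)\prod_{k=1}^{m-1}\varphi(a_ka_{n+1-k})$ when $n=2m-1$ and $i_k=i_{n+1-k}$ for all $k$, while $\varphi'(a_1\cdots a_n)=0$ otherwise.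 -/

import Mathlib

open scoped Topology

namespace MotzkinFree

universe u v

/-- A normalized linear functional `φ` on a unital complex algebra, so that `(A, φ)` is a
noncommutative probability space. -/
structure NormalizedFunctional (A : Type*) [Ring A] [Algebra ℂ A] where
  /-- The underlying linear functional. -/
  toLin : A →ₗ[ℂ] ℂ
  map_one' : toLin 1 = 1

instance {A : Type*} [Ring A] [Algebra ℂ A] :
    CoeFun (NormalizedFunctional A) (fun _ => A → ℂ) := ⟨fun φ => φ.toLin⟩

/-! ### The free product of functionals -/

section NormalizedFunctionalBasis

/-- A unital algebra with a normalized functional `φ` has a basis containing `1` whose coordinate at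
`1` is `φ`; the index type is made into a monoid only to mark that index. -/
theorem NormalizedFunctional.exists_basis {A : Type v} [Ring A] [Algebra ℂ A]
    (φ : NormalizedFunctional A) :
    ∃ (M : Type v) (_ : Monoid M) (b : Module.Basis M ℂ A), b 1 = 1 ∧ ∀ x, b.repr x 1 = φ x := by
  classical
  let K := Module.Basis.ofVectorSpaceIndex ℂ (LinearMap.ker φ.toLin)
  let bK : Module.Basis K ℂ (LinearMap.ker φ.toLin) := Module.Basis.ofVectorSpace ℂ _
  let _ : Semigroup K := { mul := fun a _ => a, mul_assoc := fun _ _ _ => rfl }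
  have hk : ∀ a : A, a - φ.toLin a • (1 : A) ∈ LinearMap.ker φ.toLin := fun a => by
    simp [φ.map_one']
  let e : (LinearMap.ker φ.toLin × ℂ) ≃ₗ[ℂ] A :=
    { toFun := fun p => p.1 + p.2 • (1 : A)
      map_add' := fun p q => by simp [add_smul]; abel
      map_smul' := fun c p => by simp [mul_smul]
      invFun := fun a => (⟨a - φ.toLin a • (1 : A), hk a⟩, φ.toLin a)
      left_inv := fun p => by
        have h1 : φ.toLin (p.1 : A) = 0 := p.1.2
        ext <;> simp [h1, φ.map_one']
      right_inv := fun a => by simp }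
  let b : Module.Basis (Option K) ℂ A :=
    (((bK.prod (Module.Basis.singleton PUnit.{1} ℂ)).map e)).reindex
      (Equiv.optionEquivSumPUnit K).symm
  refine ⟨WithOne K, inferInstance, b, ?_, fun x => ?_⟩
  · change b none = 1
    simp [b, e]
  · change b.repr x none = φ.toLin x
    simp [b, Module.Basis.prod_repr_inr]
    rfl

end NormalizedFunctionalBasis

section FreeProductFunctional

variable {I : Type u} [DecidableEq I] {A : I → Type v} [∀ i, Ring (A i)] [∀ i, Algebra ℂ (A i)]

/-- The product in the unital free product `⋆ A i` (units identified) of a list of letters. -/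
noncomputable def freeWord (l : List (Σ i, A i)) : LinearAlgebra.FreeProduct ℂ A :=
  (l.map fun s => LinearAlgebra.FreeProduct.ι ℂ A s.1 s.2).prod

/-- `ψ` is the free product of the functionals `φ i`: it is normalized, restricts to `φ i` on each
`A i`, and vanishes on alternating products of centered elements. -/
structure IsFreeProductFunctional (φ : ∀ i, NormalizedFunctional (A i))
    (ψ : LinearAlgebra.FreeProduct ℂ A →ₗ[ℂ] ℂ) : Prop where
  map_one : ψ 1 = 1
  map_ι : ∀ i (a : A i), ψ (LinearAlgebra.FreeProduct.ι ℂ A i a) = φ i a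
  map_alternating : ∀ l : List (Σ i, A i), l ≠ [] → l.IsChain (fun s s' => s.1 ≠ s'.1) →
    (∀ s ∈ l, φ s.1 s.2 = 0) → ψ (freeWord l) = 0

theorem exists_isFreeProductFunctional (φ : ∀ i, NormalizedFunctional (A i)) :
    ∃ ψ, IsFreeProductFunctional φ ψ := by
  classical
  choose M hM b hb1 hb using fun i => (φ i).exists_basis
  let Tail (i : I) := {w : Monoid.CoprodI.Word M // w.fstIdx ≠ some i}
  let pe (i : I) : Monoid.CoprodI.Word M ≃ Tail i × M i :=
    (Monoid.CoprodI.Word.equivPair i).trans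
      { toFun := fun p => (⟨p.tail, p.fstIdx_ne⟩, p.head)
        invFun := fun q => ⟨q.2, q.1.1, q.1.2⟩
        left_inv := fun _ => rfl
        right_inv := fun _ => rfl }
  let θ (i : I) : (Monoid.CoprodI.Word M →₀ ℂ) ≃ₗ[ℂ] (Tail i →₀ A i) :=
    (Finsupp.domLCongr (pe i)).trans
      ((Finsupp.curryLinearEquiv ℂ).trans (Finsupp.mapRange.linearEquiv (b i).repr.symm))
  let ρ (i : I) : A i →ₐ[ℂ] Module.End ℂ (Monoid.CoprodI.Word M →₀ ℂ) :=
    ((θ i).symm.conjAlgEquiv ℂ).toAlgHom.comp (Algebra.lsmul ℂ ℂ (Tail i →₀ A i))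
  have hρ : ∀ i a v, ρ i a v = (θ i).symm (a • θ i v) := fun i a v => by
    simp [ρ, LinearEquiv.conjAlgEquiv]
  have hpe : ∀ i (w : Tail i), pe i w.1 = (w, 1) := fun i w => by
    simp [pe, Monoid.CoprodI.Word.equivPair_eq_of_fstIdx_ne w.2]
  have hθ : ∀ i v (w : Tail i) m, (b i).repr (θ i v w) m = v ((pe i).symm (w, m)) :=
    fun i v w m => by simp [θ]
  have hθs : ∀ i f x, (θ i).symm f x = (b i).repr (f (pe i x).1) (pe i x).2 := fun i f x => by
    have := hθ i ((θ i).symm f) (pe i x).1 (pe i x).2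
    simpa using this.symm
  -- coefficient of a word not starting with `i` after a letter of label `i` acted
  have key : ∀ i a v, (∀ w : Monoid.CoprodI.Word M, w.fstIdx = some i → v w = 0) →
      ∀ u : Tail i, ρ i a v u.1 = v u.1 * φ i a := by
    intro i a v hv u
    rw [hρ, hθs, hpe]
    have h1 : θ i v u = v u.1 • (1 : A i) := by
      have hsymm : (b i).repr (1 : A i) = Finsupp.single 1 1 := by
        rw [← hb1 i, Module.Basis.repr_self]
      apply (b i).repr.injective
      ext m
      rw [hθ, map_smul, hsymm]
      by_cases hm : m = 1
      · subst hm
        rw [← hpe, Equiv.symm_apply_apply]; simp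
      · have h2 : ((pe i).symm (u, m)).fstIdx = some i := by
          change (Monoid.CoprodI.Word.rcons ⟨m, u.1, u.2⟩).fstIdx = some i
          rw [Monoid.CoprodI.Word.rcons, dif_neg hm, Monoid.CoprodI.Word.fstIdx_cons]
        rw [hv _ h2]
        simp [Ne.symm hm]
    simp [h1, hb]
  let π : LinearAlgebra.FreeProduct ℂ A →ₐ[ℂ] Module.End ℂ (Monoid.CoprodI.Word M →₀ ℂ) :=
    LinearAlgebra.FreeProduct.lift ℂ A (fun {i} => ρ i)
  have hπ : ∀ i a, π (LinearAlgebra.FreeProduct.ι ℂ A i a) = ρ i a := fun i a =>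
    DFunLike.congr_fun (LinearAlgebra.FreeProduct.lift_comp_ι ℂ A (fun {i} => ρ i) (i := i)) a
  let Ω : Monoid.CoprodI.Word M →₀ ℂ := Finsupp.single .empty 1
  let ψ : LinearAlgebra.FreeProduct ℂ A →ₗ[ℂ] ℂ :=
    (Finsupp.lapply Monoid.CoprodI.Word.empty).comp
      ((LinearMap.applyₗ Ω).comp π.toLinearMap)
  have hψ : ∀ x, ψ x = π x Ω .empty := fun _ => rfl
  refine ⟨ψ, ⟨by simp [hψ, Ω], fun i a => ?_, fun l hl hc h0 => ?_⟩⟩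
  · have h := key i a Ω (fun w hw => ?_) ⟨.empty, by simp [Monoid.CoprodI.Word.fstIdx]⟩
    · rw [hψ, hπ, h]; simp [Ω]
    · refine Finsupp.single_eq_of_ne ?_
      rintro rfl
      simp [Monoid.CoprodI.Word.fstIdx] at hw
  · have claim : ∀ l : List (Σ i, A i), l.IsChain (fun s s' => s.1 ≠ s'.1) →
        (∀ s ∈ l, φ s.1 s.2 = 0) → ∀ u : Monoid.CoprodI.Word M,
        u.fstIdx ≠ l.head?.map Sigma.fst → π (freeWord l) Ω u = 0 := by
      intro l
      induction l with
      | nil =>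
        intro _ _ u hu
        have : u ≠ .empty := by rintro rfl; simp [Monoid.CoprodI.Word.fstIdx] at hu
        simp [freeWord, Ω, Finsupp.single_eq_of_ne this]
      | cons s l ih =>
        intro hc h0 u hu
        have hw : freeWord (s :: l) = LinearAlgebra.FreeProduct.ι ℂ A s.1 s.2 * freeWord l := by
          simp [freeWord]
        have h3 := key s.1 s.2 (π (freeWord l) Ω) (fun w hw => ?_) ⟨u, by simpa using hu⟩
        · rw [hw, map_mul, hπ]
          simpa [h0 s (by simp)] using h3
        · refine ih hc.tail (fun x hx => h0 x (by simp [hx])) w ?_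
          rw [hw]
          cases l with
          | nil => simp
          | cons t l => simpa using (List.isChain_cons_cons.mp hc).1
    rw [hψ]
    refine claim l hc h0 _ ?_
    cases l with
    | nil => exact absurd rfl hl
    | cons t l => simp [Monoid.CoprodI.Word.fstIdx]

theorem freeProduct_subalgebra_eq_top (T : Subalgebra ℂ (LinearAlgebra.FreeProduct ℂ A))
    (hT : ∀ i (a : A i), LinearAlgebra.FreeProduct.ι ℂ A i a ∈ T) : T = ⊤ := by
  let f : LinearAlgebra.FreeProduct ℂ A →ₐ[ℂ] T := LinearAlgebra.FreeProduct.lift ℂ A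
    (fun {i} => (LinearAlgebra.FreeProduct.ι ℂ A i).codRestrict T (hT i))
  have hf : ∀ i (a : A i), f (LinearAlgebra.FreeProduct.ι ℂ A i a) =
      ⟨LinearAlgebra.FreeProduct.ι ℂ A i a, hT i a⟩ := fun i a =>
    DFunLike.congr_fun (LinearAlgebra.FreeProduct.lift_comp_ι ℂ A
      (fun {i} => (LinearAlgebra.FreeProduct.ι ℂ A i).codRestrict T (hT i)) (i := i)) a
  have h : T.val.comp f = AlgHom.id ℂ _ := by
    rw [LinearAlgebra.FreeProduct.lift_unique ℂ A (fun {i} => LinearAlgebra.FreeProduct.ι ℂ A i)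
      (T.val.comp f) (fun i => by ext a; simp [hf]),
      ← LinearAlgebra.FreeProduct.lift_unique ℂ A (fun {i} => LinearAlgebra.FreeProduct.ι ℂ A i)
      (AlgHom.id ℂ _) (fun i => by ext a; simp)]
  refine Algebra.eq_top_iff.mpr fun x => ?_
  have := DFunLike.congr_fun h x
  simp only [AlgHom.comp_apply, AlgHom.id_apply] at this
  rw [← this]
  exact (f x).2

theorem IsFreeProductFunctional.unique {φ : ∀ i, NormalizedFunctional (A i)}
    {ψ₁ ψ₂ : LinearAlgebra.FreeProduct ℂ A →ₗ[ℂ] ℂ} (h₁ : IsFreeProductFunctional φ ψ₁)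
    (h₂ : IsFreeProductFunctional φ ψ₂) : ψ₁ = ψ₂ := by
  let P : List (Σ i, A i) → Prop := fun l =>
    l.IsChain (fun s s' => s.1 ≠ s'.1) ∧ ∀ s ∈ l, φ s.1 s.2 = 0
  let S : Submodule ℂ (LinearAlgebra.FreeProduct ℂ A) :=
    Submodule.span ℂ {x | ∃ l, P l ∧ freeWord l = x}
  have hS : ∀ l, P l → freeWord l ∈ S := fun l hl => Submodule.subset_span ⟨l, hl, rfl⟩
  have hcons : ∀ (s : Σ i, A i) l, freeWord (s :: l) =
      LinearAlgebra.FreeProduct.ι ℂ A s.1 s.2 * freeWord l := fun s l => by simp [freeWord]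
  -- prepending a letter that may be non-centered but alternates with the word
  have step : ∀ i (a : A i) l, P l → (∀ s ∈ l.head?, i ≠ s.1) →
      LinearAlgebra.FreeProduct.ι ℂ A i a * freeWord l ∈ S := by
    intro i a l hl hi
    have hc : φ i (a - φ i a • 1) = 0 := by simp [(φ i).map_one']
    have h1 : LinearAlgebra.FreeProduct.ι ℂ A i a * freeWord l =
        freeWord (⟨i, a - φ i a • 1⟩ :: l) + φ i a • freeWord l := by
      rw [hcons]
      conv_lhs => rw [← sub_add_cancel a (φ i a • 1)]
      rw [map_add, add_mul, map_smul, _root_.map_one, smul_mul_assoc, one_mul]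
    rw [h1]
    refine S.add_mem (hS _ ⟨hl.1.cons hi, ?_⟩) (S.smul_mem _ (hS _ hl))
    rintro s hs
    rcases List.mem_cons.mp hs with rfl | hs
    · exact hc
    · exact hl.2 s hs
  have hmul : ∀ i (a : A i), ∀ y ∈ S, LinearAlgebra.FreeProduct.ι ℂ A i a * y ∈ S := by
    intro i a y hy
    induction hy using Submodule.span_induction with
    | zero => simp
    | add x y _ _ hx hy => rw [mul_add]; exact S.add_mem hx hy
    | smul c x _ hx => rw [mul_smul_comm]; exact S.smul_mem _ hx
    | mem x hx =>
      obtain ⟨l, hl, rfl⟩ := hx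
      cases l with
      | nil => exact step i a [] hl (by simp)
      | cons s l =>
        have hl' : P l := ⟨hl.1.tail, fun x hx => hl.2 x (by simp [hx])⟩
        by_cases h : i = s.1
        · obtain ⟨j, b⟩ := s
          obtain rfl : i = j := h
          rw [hcons, ← mul_assoc, ← map_mul]
          exact step i _ l hl' (List.isChain_cons.mp hl.1).1
        · exact step i a _ hl (by simpa using h)
  let T : Subalgebra ℂ (LinearAlgebra.FreeProduct ℂ A) :=
    { carrier := {x | ∀ y ∈ S, x * y ∈ S}
      mul_mem' := fun {x z} hx hz y hy => by rw [mul_assoc]; exact hx _ (hz _ hy)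
      add_mem' := fun {x z} hx hz y hy => by rw [add_mul]; exact S.add_mem (hx _ hy) (hz _ hy)
      algebraMap_mem' := fun c y hy => by
        rw [← Algebra.smul_def]; exact S.smul_mem _ hy }
  have hT : T = ⊤ := freeProduct_subalgebra_eq_top T hmul
  have hone : (1 : LinearAlgebra.FreeProduct ℂ A) ∈ S := by
    simpa [freeWord] using hS [] ⟨List.isChain_nil, by simp⟩
  have htop : ∀ x, x ∈ S := fun x => by
    have hx : x ∈ T := hT ▸ Algebra.mem_top
    simpa using hx 1 hone
  ext x
  refine Submodule.span_induction (p := fun x _ => ψ₁ x = ψ₂ x) ?_ (by simp)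
    (fun x y _ _ hx hy => by rw [map_add, map_add, hx, hy])
    (fun c x _ hx => by rw [map_smul, map_smul, hx]) (htop x)
  rintro _ ⟨l, hl, rfl⟩
  by_cases h : l = []
  · subst h
    simp [freeWord, h₁.map_one, h₂.map_one]
  · rw [h₁.map_alternating l h hl.1 hl.2, h₂.map_alternating l h hl.1 hl.2]

/-- The free product `⋆ φ i` of normalized functionals exists and is unique. -/
theorem existsUnique_freeProductFunctional (φ : ∀ i, NormalizedFunctional (A i)) :
    ∃! ψ, IsFreeProductFunctional φ ψ := by
  obtain ⟨ψ, hψ⟩ := exists_isFreeProductFunctional φ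
  exact ⟨ψ, hψ, fun _ h => h.unique hψ⟩

/-- The free product functional `⋆ φ i` on `⋆ A i`. -/
noncomputable def freeProductFunctional (φ : ∀ i, NormalizedFunctional (A i)) :
    LinearAlgebra.FreeProduct ℂ A →ₗ[ℂ] ℂ :=
  (existsUnique_freeProductFunctional φ).choose

theorem freeProductFunctional_spec (φ : ∀ i, NormalizedFunctional (A i)) :
    IsFreeProductFunctional φ (freeProductFunctional φ) :=
  (existsUnique_freeProductFunctional φ).choose_spec.1

end FreeProductFunctional

/-! ### The free product without identification of units -/

section NonIdentified

variable {I : Type u} [DecidableEq I] (A : I → Type v) [∀ i, Ring (A i)] [∀ i, Algebra ℂ (A i)]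

/-- The free product `* A i` without identification of units. The unit `1_i` of `A i` becomes an
internal unit (a mere idempotent) because an external unit is first adjoined to each `A i`; only the
external units are identified. -/
abbrev FreeProductWithoutUnits : Type (max u v) :=
  LinearAlgebra.FreeProduct ℂ (fun i => Unitization ℂ (A i))

/-- The unit identification map `τ : * A i → ⋆ A i`. -/
noncomputable def unitIdentification :
    FreeProductWithoutUnits A →ₐ[ℂ] LinearAlgebra.FreeProduct ℂ A :=
  LinearAlgebra.FreeProduct.lift ℂ (fun i => Unitization ℂ (A i))
    (fun {i} => Unitization.lift (LinearAlgebra.FreeProduct.ι ℂ A i : A i →ₙₐ[ℂ] _))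

variable {A}

/-- The copy of `a ∈ A i` in `* A i`. -/
noncomputable def letter (i : I) (a : A i) : FreeProductWithoutUnits A :=
  LinearAlgebra.FreeProduct.ι ℂ (fun i => Unitization ℂ (A i)) i (Unitization.inr a)

/-- The product `a_1 ⋯ a_n` in `* A i`. -/
noncomputable def word {n : ℕ} {i : Fin n → I} (a : ∀ k, A (i k)) : FreeProductWithoutUnits A :=
  (List.ofFn fun k => letter (i k) (a k)).prod

/-- The functional `(⋆ φ i) ∘ τ` on `* A i`. -/
noncomputable def freeFunctional (φ : ∀ i, NormalizedFunctional (A i)) :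
    FreeProductWithoutUnits A →ₗ[ℂ] ℂ :=
  (freeProductFunctional φ).comp (unitIdentification A).toLinearMap

end NonIdentified

/-! ### Boolean extensions -/

section BooleanExtension

variable (A : Type v) [Ring A] [Algebra ℂ A]

/-- The relations presenting `A ⋆ alg(p)`: the generators `some a` form a copy of the unital algebra
`A` (with the same unit) and the generator `none` is an idempotent. -/
inductive BooleanExtRel : FreeAlgebra ℂ (Option A) → FreeAlgebra ℂ (Option A) → Prop
  | add (a b : A) : BooleanExtRel (FreeAlgebra.ι ℂ (some (a + b)))
      (FreeAlgebra.ι ℂ (some a) + FreeAlgebra.ι ℂ (some b))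
  | smul (c : ℂ) (a : A) : BooleanExtRel (FreeAlgebra.ι ℂ (some (c • a)))
      (c • FreeAlgebra.ι ℂ (some a))
  | mul (a b : A) : BooleanExtRel (FreeAlgebra.ι ℂ (some (a * b)))
      (FreeAlgebra.ι ℂ (some a) * FreeAlgebra.ι ℂ (some b))
  | one : BooleanExtRel (FreeAlgebra.ι ℂ (some 1)) 1
  | idem : BooleanExtRel (FreeAlgebra.ι ℂ none * FreeAlgebra.ι ℂ none) (FreeAlgebra.ι ℂ none)

/-- The algebra `A ⋆ alg(p)`: the free product, with identified units, of `A` with the algebra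
generated by an idempotent `p`. -/
def BooleanExt : Type v := RingQuot (BooleanExtRel A)

noncomputable instance : Ring (BooleanExt A) := inferInstanceAs (Ring (RingQuot (BooleanExtRel A)))

noncomputable instance : Algebra ℂ (BooleanExt A) :=
  inferInstanceAs (Algebra ℂ (RingQuot (BooleanExtRel A)))

/-- The quotient map from the free algebra on the generators. -/
noncomputable def BooleanExt.mk : FreeAlgebra ℂ (Option A) →ₐ[ℂ] BooleanExt A :=
  RingQuot.mkAlgHom ℂ (BooleanExtRel A)

variable {A} in
theorem BooleanExt.mk_rel {x y : FreeAlgebra ℂ (Option A)} (h : BooleanExtRel A x y) :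
    BooleanExt.mk A x = BooleanExt.mk A y :=
  RingQuot.mkAlgHom_rel ℂ h

variable {A}

/-- The idempotent `p`. -/
noncomputable def idemP : BooleanExt A :=
  BooleanExt.mk A (FreeAlgebra.ι ℂ none)

theorem idemP_mul_idemP : (idemP : BooleanExt A) * idemP = idemP := by
  rw [idemP, ← map_mul]
  exact BooleanExt.mk_rel .idem

/-- The embedding of `A` into `A ⋆ alg(p)`. -/
noncomputable def ofAlg : A →ₐ[ℂ] BooleanExt A :=
  AlgHom.ofLinearMap
    { toFun := fun a => BooleanExt.mk A (FreeAlgebra.ι ℂ (some a))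
      map_add' := fun a b => by
        rw [← map_add]; exact BooleanExt.mk_rel (.add a b)
      map_smul' := fun c a => by
        rw [RingHom.id_apply, ← map_smul]; exact BooleanExt.mk_rel (.smul c a) }
    ((BooleanExt.mk_rel .one).trans (map_one _))
    (fun a b => by
      simp only [LinearMap.coe_mk, AddHom.coe_mk]
      rw [← map_mul]; exact BooleanExt.mk_rel (.mul a b))

/-- The representation of `A ⋆ alg(p)` on the vector space `A` in which `A` acts by left
multiplication and `p` acts as the projection `x ↦ φ(x) 1`. -/
noncomputable def booleanRep (φ : NormalizedFunctional A) : BooleanExt A →ₐ[ℂ] Module.End ℂ A :=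
  RingQuot.liftAlgHom ℂ ⟨FreeAlgebra.lift ℂ
    (fun o => o.elim (φ.toLin.smulRight (1 : A)) (fun a => Algebra.lmul ℂ A a)), by
      intro x y h
      induction h with
      | add a b => simp
      | smul c a => simp
      | mul a b => ext x; simp [mul_assoc]
      | one => ext x; simp
      | idem => ext x; simp [φ.map_one']⟩

/-- The Boolean extension `φ̃` of `φ` to `A ⋆ alg(p)`. -/
noncomputable def booleanExtFunctional (φ : NormalizedFunctional A) : BooleanExt A →ₗ[ℂ] ℂ :=
  φ.toLin.comp ((LinearMap.applyₗ (1 : A)).comp (booleanRep φ).toLinearMap)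

theorem booleanRep_mk (φ : NormalizedFunctional A) (x : FreeAlgebra ℂ (Option A)) :
    booleanRep φ (BooleanExt.mk A x) = FreeAlgebra.lift ℂ
      (fun o : Option A => o.elim (φ.toLin.smulRight (1 : A)) (fun a => Algebra.lmul ℂ A a)) x :=
  RingQuot.liftAlgHom_mkAlgHom_apply _ _ _ _

theorem booleanRep_idemP (φ : NormalizedFunctional A) (x : A) :
    booleanRep φ idemP x = φ x • 1 := by
  simp [booleanRep_mk, idemP]

theorem booleanRep_ofAlg (φ : NormalizedFunctional A) (a x : A) :
    booleanRep φ (ofAlg a) x = a * x := by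
  simp [booleanRep_mk, ofAlg]

/-- The defining formula `φ̃(p^α a_1 p a_2 p ⋯ p a_n p^β) = φ(a_1) ⋯ φ(a_n)` of the Boolean
extension. -/
theorem booleanExtFunctional_alternating (φ : NormalizedFunctional A) (l : List A) (α β : ℕ) :
    booleanExtFunctional φ (idemP ^ α * ((l.map ofAlg).intersperse idemP).prod * idemP ^ β) =
      (l.map fun a => φ a).prod := by
  have hpow : ∀ β : ℕ, booleanRep φ (idemP ^ β) 1 = 1 := by
    intro β
    induction β with
    | zero => simp
    | succ k ih =>
      rw [pow_succ, map_mul, Module.End.mul_apply, booleanRep_idemP, φ.map_one', one_smul, ih]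
  have hφp : ∀ (α : ℕ) x, φ (booleanRep φ (idemP ^ α) x) = φ x := by
    intro α
    induction α with
    | zero => simp
    | succ k ih =>
      intro x
      rw [pow_succ, map_mul, Module.End.mul_apply, ih, booleanRep_idemP]; simp [φ.map_one']
  have hl : φ (booleanRep φ ((l.map ofAlg).intersperse idemP).prod 1) =
      (l.map fun a => φ a).prod := by
    induction l with
    | nil => simp [φ.map_one']
    | cons a l ih =>
      cases l with
      | nil => simp [booleanRep_ofAlg]
      | cons b l =>
        simp only [List.map_cons, List.intersperse_cons_cons, List.prod_cons, map_mul,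
          Module.End.mul_apply, booleanRep_ofAlg, booleanRep_idemP] at ih ⊢
        rw [ih]
        simp [mul_comm]
  simp only [booleanExtFunctional, LinearMap.comp_apply, AlgHom.toLinearMap_apply,
    LinearMap.applyₗ_apply_apply, map_mul, Module.End.mul_apply, hpow]
  rw [hφp, hl]

end BooleanExtension

/-! ### Infinite tensor products -/

section TensorProduct

variable {S : Type u} {B : S → Type v} [∀ s, Ring (B s)] [∀ s, Algebra ℂ (B s)]

theorem finite_update [DecidableEq S] (f : ∀ s, B s →ₗ[ℂ] ℂ) (m : ∀ s, B s) (s : S) (x : B s) :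
    {t | f t (Function.update m s x t) ≠ 1}.Finite ↔ {t | t ≠ s ∧ f t (m t) ≠ 1}.Finite := by
  constructor
  · refine fun h => h.subset ?_
    rintro t ⟨ht, h1⟩
    simpa [Function.update_of_ne ht] using h1
  · refine fun h => (h.insert s).subset fun t ht => ?_
    by_cases hs : t = s
    · exact Or.inl hs
    · exact Or.inr ⟨hs, by simpa [Function.update_of_ne hs] using ht⟩

theorem finprod_update [DecidableEq S] (f : ∀ s, B s →ₗ[ℂ] ℂ) (m : ∀ s, B s) (s : S) (x : B s)
    (h : {t | t ≠ s ∧ f t (m t) ≠ 1}.Finite) :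
    ∏ᶠ t, f t (Function.update m s x t) =
      f s x * ∏ᶠ t, (if t = s then 1 else f t (m t)) := by
  have h1 : ∀ t, f t (Function.update m s x t) =
      (Pi.mulSingle s (f s x) : S → ℂ) t * (if t = s then 1 else f t (m t)) := by
    intro t
    by_cases ht : t = s
    · subst ht; simp
    · simp [ht]
  rw [finprod_congr h1, finprod_mul_distrib]
  · congr 1
    rw [finprod_eq_single _ s]
    · simp
    · intro t ht; simp [ht]
  · exact (Set.finite_singleton s).subset Pi.mulSupport_mulSingle_subset
  · refine h.subset fun t ht => ?_
    by_cases hs : t = s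
    · simp [hs] at ht
    · exact ⟨hs, by simpa [hs] using ht⟩

open Classical in
/-- The product `⊗ f s` of linear functionals on the (possibly infinite) tensor product `⨂ B s`. On
a simple tensor `⊗ x s` with `f s (x s) = 1` for all but finitely many `s` it is the (finite) product
of the numbers `f s (x s)`; on the other simple tensors, whose factors do not give a finite product,
it is `0`. -/
noncomputable def productFunctional (f : ∀ s, B s →ₗ[ℂ] ℂ) : PiTensorProduct ℂ B →ₗ[ℂ] ℂ :=
  PiTensorProduct.lift
    { toFun := fun x =>
        if {s | f s (x s) ≠ 1}.Finite then ∏ᶠ s, f s (x s) else 0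
      map_update_add' := fun {_} m s x y => by
        simp only [finite_update]
        split_ifs with h
        · simp only [finprod_update f m s _ h, map_add, add_mul]
        · simp
      map_update_smul' := fun {_} m s c x => by
        simp only [finite_update]
        split_ifs with h
        · simp only [finprod_update f m s _ h, map_smul, smul_mul_assoc]
        · simp }

theorem productFunctional_tprod (f : ∀ s, B s →ₗ[ℂ] ℂ) (x : ∀ s, B s)
    (hx : {s | f s (x s) ≠ 1}.Finite) :
    productFunctional f (PiTensorProduct.tprod ℂ x) = ∏ᶠ s, f s (x s) := by
  simp [productFunctional, hx]

end TensorProduct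

/-! ### Orthogonal replicas and Motzkin functionals -/

section Motzkin

/-- Reduced Motzkin words `w = j_1 ⋯ j_n`: letters are positive integers, the first and the last
letter are `1`, and consecutive letters differ by `-1`, `0` or `1`. -/
def IsReducedMotzkinWord {n : ℕ} (w : Fin n → ℕ+) : Prop :=
  (∀ k : Fin n, (k : ℕ) = 0 → w k = 1) ∧
  (∀ k : Fin n, (k : ℕ) + 1 = n → w k = 1) ∧
  ∀ k l : Fin n, (l : ℕ) = k + 1 →
    ((w l : ℕ) : ℤ) - ((w k : ℕ) : ℤ) ∈ ({-1, 0, 1} : Set ℤ)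

theorem finite_reducedMotzkinWords (n : ℕ) :
    {w : Fin n → ℕ+ | IsReducedMotzkinWord w}.Finite := by
  have hb : ∀ w : Fin n → ℕ+, IsReducedMotzkinWord w → ∀ (k : ℕ) (hk : k < n),
      (w ⟨k, hk⟩ : ℕ) ≤ k + 1 := by
    intro w hw k
    induction k with
    | zero => intro hk; simp [hw.1 ⟨0, hk⟩ rfl]
    | succ k ih =>
      intro hk
      have h1 := ih (by omega)
      have h2 := hw.2.2 ⟨k, by omega⟩ ⟨k + 1, hk⟩ rfl
      simp only [Set.mem_insert_iff, Set.mem_singleton_iff] at h2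
      omega
  refine (Set.Finite.pi' (t := fun _ : Fin n => Set.Iic (n.succPNat)) fun _ =>
    Set.finite_Iic _).subset fun w hw k => ?_
  have := hb w hw k k.2
  rw [Set.mem_Iic, ← PNat.coe_le_coe, Nat.succPNat_coe]
  have := k.2
  simp only [Fin.eta] at *
  omega

/-- The finite set `M_n` of reduced Motzkin words of length `n`. -/
noncomputable def motzkinWords (n : ℕ) : Finset (Fin n → ℕ+) :=
  (finite_reducedMotzkinWords n).toFinset

variable {I : Type u} [DecidableEq I] (A : I → Type v) [∀ i, Ring (A i)] [∀ i, Algebra ℂ (A i)]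

/-- The tensor product over all sites `(i, j)`, with label `i ∈ I` and color `j = 1, 2, …`, of copies
of `A i ⋆ alg(p_i)`. -/
abbrev ReplicaTensor : Type (max u v) :=
  PiTensorProduct ℂ (fun s : I × ℕ+ => BooleanExt (A s.1))

/-- The projection `P_{i,j}`, having `p` at all sites of label different from `i` and color at
least `j` and internal units elsewhere, for `j ≥ 1`; by convention `P_{i,0} = 0`. -/
noncomputable def replicaProj (i : I) (j : ℕ) : ReplicaTensor A :=
  if j = 0 then 0
  else PiTensorProduct.tprod ℂ
    (fun s : I × ℕ+ => if s.1 ≠ i ∧ j ≤ (s.2 : ℕ) then (idemP : BooleanExt (A s.1)) else 1)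

variable {A}

/-- The orthogonal replica `a(j) = a_{i,j} ⊗ (P_{i,j} - P_{i,j-1})` of `a ∈ A i` of color `j`. -/
noncomputable def replica (i : I) (a : A i) (j : ℕ+) : ReplicaTensor A :=
  PiTensorProduct.singleAlgHom (A := fun s : I × ℕ+ => BooleanExt (A s.1)) (R := ℂ)
      ((i, j) : I × ℕ+) (ofAlg a) *
    (replicaProj A i j - replicaProj A i ((j : ℕ) - 1))

/-- The Motzkin functional `Φ_w(a_1, …, a_n) = Φ(a_1(j_1) ⋯ a_n(j_n))`, where `w = j_1 ⋯ j_n` and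
`Φ` is the tensor product of the Boolean extensions of the `φ i` over all sites. -/
noncomputable def motzkinFunctional (φ : ∀ i, NormalizedFunctional (A i)) {n : ℕ} {i : Fin n → I}
    (w : Fin n → ℕ+) (a : ∀ k, A (i k)) : ℂ :=
  productFunctional (fun s : I × ℕ+ => booleanExtFunctional (φ s.1))
    (List.ofFn fun k => replica (i k) (a k) (w k)).prod

end Motzkin

/-! ### Deformations -/

section Deformation

variable {I : Type u} {A : I → Type v} [∀ i, Ring (A i)] [∀ i, Algebra ℂ (A i)]

/-- A (first order) deformation `φ_{i,t} = φ_i + t φ'_i + o(t)`, `t ∈ (-ε, ε)`, of the functionals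
`φ_i` by normalized linear functionals, where `φ'_i` is linear with `φ'_i(1) = 0`. The expansion is
pointwise. The values of `toLin t` for `|t| ≥ ε` are irrelevant. -/
structure Deformation (φ : ∀ i, NormalizedFunctional (A i)) where
  /-- The range of the parameter. -/
  ε : ℝ
  ε_pos : 0 < ε
  /-- The functionals `φ_{i,t}`. -/
  toLin : ℝ → ∀ i, A i →ₗ[ℂ] ℂ
  map_one' : ∀ t : ℝ, |t| < ε → ∀ i, toLin t i 1 = 1
  /-- The functionals `φ'_i`. -/
  der : ∀ i, A i →ₗ[ℂ] ℂ
  der_one : ∀ i, der i 1 = 0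
  expansion : ∀ i (a : A i),
    (fun t : ℝ => toLin t i a - (φ i a + (t : ℂ) * der i a)) =o[𝓝 0] (fun t : ℝ => t)

namespace Deformation

variable {φ : ∀ i, NormalizedFunctional (A i)} (D : Deformation φ)

/-- The normalized functionals `φ_{i,t}` for `|t| < ε` (and `φ_i` for other `t`). -/
noncomputable def state (t : ℝ) (i : I) : NormalizedFunctional (A i) :=
  if h : |t| < D.ε then ⟨D.toLin t i, D.map_one' t h i⟩ else φ i

variable [DecidableEq I]

/-- `φ_t = (⋆ φ_{i,t}) ∘ τ`. -/
noncomputable def freeFunctionalAt (t : ℝ) : FreeProductWithoutUnits A →ₗ[ℂ] ℂ :=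
  freeFunctional (D.state t)

/-- `φ' = d φ_t / dt` at `t = 0`. -/
noncomputable def freeDerivative (x : FreeProductWithoutUnits A) : ℂ :=
  deriv (fun t : ℝ => D.freeFunctionalAt t x) 0

/-- The deformed Motzkin functionals `Φ_{w,t}`. -/
noncomputable def motzkinFunctionalAt (t : ℝ) {n : ℕ} {i : Fin n → I} (w : Fin n → ℕ+)
    (a : ∀ k, A (i k)) : ℂ :=
  motzkinFunctional (D.state t) w a

/-- The infinitesimal Motzkin functionals `Φ'_w = d Φ_{w,t} / dt` at `t = 0`. -/
noncomputable def infinitesimalMotzkin {n : ℕ} {i : Fin n → I} (w : Fin n → ℕ+)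
    (a : ∀ k, A (i k)) : ℂ :=
  deriv (fun t : ℝ => D.motzkinFunctionalAt t w a) 0

end Deformation

/-- Neighboring labels are different: `i_1 ≠ i_2 ≠ ⋯ ≠ i_n`. -/
def Alternating {n : ℕ} (i : Fin n → I) : Prop :=
  ∀ k l : Fin n, (l : ℕ) = k + 1 → i k ≠ i l

/-- An element of `A i` regarded as an element of `A j` when `i = j`. -/
def relabel {i j : I} (h : i = j) (a : A i) : A j := h ▸ a

/-- The middle position among `n = 2 * m + 1` positions. -/
def middle {n m : ℕ} (h : n = 2 * m + 1) : Fin n := ⟨m, by omega⟩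

/-- The `k`-th position among `n = 2 * m + 1` positions, for `k` in the first half; the symmetric
position is `(left h k).rev`. -/
def left {n m : ℕ} (h : n = 2 * m + 1) (k : Fin m) : Fin n := ⟨k, by omega⟩

end Deformation

end MotzkinFree

open MotzkinFree

set_option linter.unusedSectionVars false

namespace MotzkinFree

/-! ### Action of orthogonal replicas on tensor words, modulo the left kernel of `Φ`. -/

section TensorVectors

universe u v
variable {I : Type u} [DecidableEq I] {A : I → Type v} [∀ i, Ring (A i)] [∀ i, Algebra ℂ (A i)]

/-! The decomposition into Motzkin functionals comes from a tensor model of the free product. Place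
the letters of an alternating word of `φ`-centered elements at sites of colors `1, 2, …` counted
from the right (`tensorWord`). Modulo the left kernel of `Φ` (`vacuumIdeal`), these tensors behave
like the words of a free product space on which the replica `a(j)` acts. The factor `P_{i,j} -
P_{i,j-1}` selects, among words not beginning with label `i`, those of length `j - 1`, and it
commutes with the sites of label `i`. So exactly one color contributes on each word, and the sum of
`a(j)` over all sufficiently many colors acts as left multiplication by `a`. Evaluating at the empty
word yields free moments (`siteFunctional_prod_replicaSum`).

Expanding the product of these sums gives one term for each sequence of colors. A color can differ
by at most one from the next, since both are tied to the length of the same intermediate word, and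
the first and last colors are `1` because the word starts and ends empty
(`isReducedMotzkinWord_of_ne_zero`). Hence each free moment is a finite sum of Motzkin functionals,
for every choice of functionals. Each term depends differentiably on `t`, so the identity can be
differentiated term by term.

The centered formula is independent of Motzkin words. For every `t` the alternating product of the
letters recentered by `φ_{i,t}` has moment `0`. Restoring the original letters one at a time and
differentiating shows that `φ'(a_1 ⋯ a_n)` is the sum over `k` of `φ'_{i_k}(a_k)` times the moment
of the word with letter `k` removed (`hasDerivAt_freeProductFunctional_sub_center`). Such a word is
two centered alternating words glued at one junction. It contracts from the junction outwards, and
its moment vanishes unless both halves have the same length and mirrored labels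
(`freeProductFunctional_reverse_append`), which leaves only the middle letter. -/

theorem booleanExtFunctional_mul_idemP {A : Type*} [Ring A] [Algebra ℂ A]
    (φ : NormalizedFunctional A) (y : BooleanExt A) :
    booleanExtFunctional φ (y * idemP) = booleanExtFunctional φ y := by
  simp [booleanExtFunctional, booleanRep_idemP, φ.map_one']

theorem booleanExtFunctional_mul_idemP_mul_ofAlg {A : Type*} [Ring A] [Algebra ℂ A]
    (φ : NormalizedFunctional A) (y : BooleanExt A) (a : A) :
    booleanExtFunctional φ (y * (idemP * ofAlg a)) = φ a * booleanExtFunctional φ y := by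
  simp [booleanExtFunctional, booleanRep_idemP, booleanRep_ofAlg]

theorem booleanExtFunctional_ofAlg {A : Type*} [Ring A] [Algebra ℂ A]
    (φ : NormalizedFunctional A) (a : A) : booleanExtFunctional φ (ofAlg a) = φ a := by
  simp [booleanExtFunctional, booleanRep_ofAlg]

/-- The tensor product over all sites of the Boolean extensions of the `φ i`. -/
noncomputable def siteFunctional (φ : ∀ i, NormalizedFunctional (A i)) :
    ReplicaTensor A →ₗ[ℂ] ℂ :=
  productFunctional (fun s : I × ℕ+ => booleanExtFunctional (φ s.1))

theorem siteFunctional_tprod_congr (φ : ∀ i, NormalizedFunctional (A i))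
    {z z' : ∀ s : I × ℕ+, BooleanExt (A s.1)}
    (h : ∀ s, booleanExtFunctional (φ s.1) (z s) = booleanExtFunctional (φ s.1) (z' s)) :
    siteFunctional φ (PiTensorProduct.tprod ℂ z) =
      siteFunctional φ (PiTensorProduct.tprod ℂ z') := by
  have hs : {s | booleanExtFunctional (φ s.1) (z s) ≠ 1} =
      {s | booleanExtFunctional (φ s.1) (z' s) ≠ 1} := by
    ext s; simp only [Set.mem_ofPred_eq, h]
  simp only [siteFunctional, productFunctional, PiTensorProduct.lift.tprod, MultilinearMap.coe_mk]
  classical exact if_congr (iff_of_eq (congrArg Set.Finite hs)) (finprod_congr h) rfl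

/-- One vanishing factor suffices: the finite product is then `0`, and the default value for
infinitely many nontrivial factors is `0` as well. -/
theorem siteFunctional_tprod_eq_zero (φ : ∀ i, NormalizedFunctional (A i))
    {z : ∀ s : I × ℕ+, BooleanExt (A s.1)} (s : I × ℕ+)
    (h : booleanExtFunctional (φ s.1) (z s) = 0) :
    siteFunctional φ (PiTensorProduct.tprod ℂ z) = 0 := by
  simp only [siteFunctional, productFunctional, PiTensorProduct.lift.tprod, MultilinearMap.coe_mk]
  split_ifs with hf
  · exact finprod_eq_zero _ s h hf
  · rfl

theorem siteFunctional_one (φ : ∀ i, NormalizedFunctional (A i)) : siteFunctional φ 1 = 1 := by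
  have h : ∀ s : I × ℕ+, booleanExtFunctional (φ s.1) 1 = 1 := fun s => by
    simp [booleanExtFunctional, (φ s.1).map_one']
  rw [PiTensorProduct.one_def, siteFunctional, productFunctional_tprod] <;> simp [h]

/-- The left kernel of `siteFunctional φ`: the elements vanishing on the vacuum vector. -/
noncomputable def vacuumIdeal (φ : ∀ i, NormalizedFunctional (A i)) :
    Submodule ℂ (ReplicaTensor A) where
  carrier := {x | ∀ y, siteFunctional φ (y * x) = 0}
  add_mem' hx hx' y := by rw [mul_add, map_add, hx, hx', add_zero]
  zero_mem' y := by simp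
  smul_mem' c x hx y := by rw [mul_smul_comm, map_smul, hx, smul_zero]

variable {φ : ∀ i, NormalizedFunctional (A i)}

theorem mul_mem_vacuumIdeal (y : ReplicaTensor A) {x : ReplicaTensor A}
    (hx : x ∈ vacuumIdeal φ) : y * x ∈ vacuumIdeal φ := fun z => by
  rw [← mul_assoc]; exact hx _

theorem siteFunctional_mul_congr {x x' : ReplicaTensor A} (h : x - x' ∈ vacuumIdeal φ)
    (y : ReplicaTensor A) : siteFunctional φ (y * x) = siteFunctional φ (y * x') := by
  rw [← sub_eq_zero, ← map_sub, ← mul_sub]; exact h y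

theorem tprod_mem_vacuumIdeal {z : ∀ s : I × ℕ+, BooleanExt (A s.1)} (s : I × ℕ+)
    (h : ∀ y, booleanExtFunctional (φ s.1) (y * z s) = 0) :
    PiTensorProduct.tprod ℂ z ∈ vacuumIdeal φ := fun y => by
  induction y using PiTensorProduct.induction_on with
  | smul_tprod r y =>
    rw [smul_mul_assoc, map_smul, PiTensorProduct.tprod_mul_tprod,
      siteFunctional_tprod_eq_zero φ s (h _), smul_zero]
  | add x y hx hy => rw [add_mul, map_add, hx, hy, add_zero]

theorem tprod_sub_tprod_mem_vacuumIdeal {z z' : ∀ s : I × ℕ+, BooleanExt (A s.1)}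
    (h : ∀ s y, booleanExtFunctional (φ s.1) (y * z s) =
      booleanExtFunctional (φ s.1) (y * z' s)) :
    PiTensorProduct.tprod ℂ z - PiTensorProduct.tprod ℂ z' ∈ vacuumIdeal φ := fun y => by
  induction y using PiTensorProduct.induction_on with
  | smul_tprod r y =>
    rw [mul_sub, smul_mul_assoc, smul_mul_assoc, map_sub, map_smul, map_smul,
      PiTensorProduct.tprod_mul_tprod, PiTensorProduct.tprod_mul_tprod,
      siteFunctional_tprod_congr φ (z := y * z) (z' := y * z') (fun s => h s (y s)), sub_self]
  | add x y hx hy => rw [add_mul, map_add, hx, hy, add_zero]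

/-- The element `x` placed at the site `(i, j)`. -/
noncomputable def atSite (i : I) (j : ℕ+) : BooleanExt (A i) →ₐ[ℂ] ReplicaTensor A :=
  PiTensorProduct.singleAlgHom (A := fun s : I × ℕ+ => BooleanExt (A s.1)) (R := ℂ)
    ((i, j) : I × ℕ+)

theorem atSite_apply (i : I) (j : ℕ+) (x : BooleanExt (A i)) :
    atSite (A := A) i j x = PiTensorProduct.tprod ℂ
      (Pi.mulSingle (M := fun s : I × ℕ+ => BooleanExt (A s.1)) ((i, j) : I × ℕ+) x) := rfl

theorem replica_eq (i : I) (a : A i) (j : ℕ+) : replica i a j =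
    atSite i j (ofAlg a) * (replicaProj A i j - replicaProj A i ((j : ℕ) - 1)) := rfl

/-- The components of `tensorWord l`. -/
noncomputable def siteFamily : List (Σ i, A i) → ∀ s : I × ℕ+, BooleanExt (A s.1)
  | [] => 1
  | a :: l => Pi.mulSingle (M := fun s : I × ℕ+ => BooleanExt (A s.1))
      ((a.1, l.length.succPNat) : I × ℕ+) (ofAlg a.2) * siteFamily l

/-- The letters of a word placed at the sites of colors `1, 2, …`, from right to left. -/
noncomputable def tensorWord (l : List (Σ i, A i)) : ReplicaTensor A :=
  PiTensorProduct.tprod ℂ (siteFamily l)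

theorem tensorWord_nil : tensorWord ([] : List (Σ i, A i)) = 1 := rfl

theorem tensorWord_cons (a : Σ i, A i) (l : List (Σ i, A i)) :
    tensorWord (a :: l) = atSite a.1 l.length.succPNat (ofAlg a.2) * tensorWord l := by
  rw [atSite_apply, tensorWord, tensorWord, PiTensorProduct.tprod_mul_tprod, siteFamily]

theorem siteFamily_eq_one (l : List (Σ i, A i)) (s : I × ℕ+) (h : l.length < (s.2 : ℕ)) :
    siteFamily l s = 1 := by
  induction l with
  | nil => rfl
  | cons a l ih =>
    have hs : s ≠ (a.1, l.length.succPNat) := by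
      rintro rfl; simp at h
    rw [siteFamily, Pi.mul_apply, Pi.mulSingle_eq_of_ne hs, one_mul]
    exact ih (by simp at h; omega)

theorem siteFamily_cons_self (a : Σ i, A i) (l : List (Σ i, A i)) :
    siteFamily (a :: l) ((a.1, l.length.succPNat) : I × ℕ+) = ofAlg a.2 := by
  rw [siteFamily, Pi.mul_apply, Pi.mulSingle_eq_same, siteFamily_eq_one _ _ (by simp), mul_one]

/-- Alternating words of centered letters. -/
def IsReducedWord (φ : ∀ i, NormalizedFunctional (A i)) (l : List (Σ i, A i)) : Prop :=
  l.IsChain (fun s s' => s.1 ≠ s'.1) ∧ ∀ s ∈ l, φ s.1 s.2 = 0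

theorem IsReducedWord.tail {a : Σ i, A i} {l : List (Σ i, A i)} (h : IsReducedWord φ (a :: l)) :
    IsReducedWord φ l :=
  ⟨h.1.tail, fun s hs => h.2 s (by simp [hs])⟩

theorem IsReducedWord.cons {a : Σ i, A i} {l : List (Σ i, A i)} (h : IsReducedWord φ l)
    (ha : φ a.1 a.2 = 0) (hal : ∀ s ∈ l.head?, a.1 ≠ s.1) : IsReducedWord φ (a :: l) :=
  ⟨h.1.cons hal, fun s hs => by
    rcases List.mem_cons.mp hs with rfl | hs
    exacts [ha, h.2 s hs]⟩

theorem siteFunctional_tensorWord {l : List (Σ i, A i)} (h : IsReducedWord φ l) (hl : l ≠ []) :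
    siteFunctional φ (tensorWord l) = 0 := by
  cases l with
  | nil => exact absurd rfl hl
  | cons a l =>
    refine siteFunctional_tprod_eq_zero φ ((a.1, l.length.succPNat) : I × ℕ+) ?_
    rw [siteFamily_cons_self, booleanExtFunctional_ofAlg]
    exact h.2 a (by simp)

theorem replicaProj_mul_tensorWord (i : I) {j : ℕ} (hj : j ≠ 0) (l : List (Σ i, A i)) :
    replicaProj A i j * tensorWord l = PiTensorProduct.tprod ℂ (fun s : I × ℕ+ =>
      if s.1 ≠ i ∧ j ≤ (s.2 : ℕ) then idemP * siteFamily l s else siteFamily l s) := by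
  rw [replicaProj, if_neg hj, tensorWord, PiTensorProduct.tprod_mul_tprod]
  congr 1
  ext s
  simp only [Pi.mul_apply]
  split_ifs <;> simp

/-- All the idempotents of the projection sit at colors beyond the word, where the component is `1`;
there `p` fixes the vacuum vector. -/
theorem replicaProj_mul_tensorWord_of_lt (i : I) {j : ℕ} {l : List (Σ i, A i)}
    (hj : l.length < j) :
    replicaProj A i j * tensorWord l - tensorWord l ∈ vacuumIdeal φ := by
  rw [replicaProj_mul_tensorWord i (by omega)]
  refine tprod_sub_tprod_mem_vacuumIdeal fun s y => ?_
  split_ifs with h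
  · rw [siteFamily_eq_one _ _ (by omega), mul_one, mul_one, booleanExtFunctional_mul_idemP]
  · rfl

/-- The site of the leading letter receives `p a`, which sends the vacuum to `φ(a) = 0` times
itself. The case `j = 0` rests on the convention `P_{i,0} = 0`. -/
theorem replicaProj_mul_tensorWord_of_le (i : I) {j : ℕ} {l : List (Σ i, A i)}
    (hl : IsReducedWord φ l) (hi : ∀ s ∈ l.head?, i ≠ s.1) (hj : j ≤ l.length) :
    replicaProj A i j * tensorWord l ∈ vacuumIdeal φ := by
  by_cases h0 : j = 0
  · simp [replicaProj, h0]
  rw [replicaProj_mul_tensorWord i h0]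
  cases l with
  | nil => simp at hj; omega
  | cons a l =>
    refine tprod_mem_vacuumIdeal ((a.1, l.length.succPNat) : I × ℕ+) fun y => ?_
    have h1 : a.1 ≠ i ∧ j ≤ ((l.length.succPNat : ℕ+) : ℕ) :=
      ⟨(hi a (by simp)).symm, by simpa using hj⟩
    simp only [if_pos h1, siteFamily_cons_self]
    rw [booleanExtFunctional_mul_idemP_mul_ofAlg, hl.2 a (by simp), zero_mul]

/-- Both projections kill the word if `j` is at most its length, and both fix it if `j` exceeds the
length by at least two. They differ only in between. -/
theorem replicaProj_sub_mul_tensorWord (i : I) (j : ℕ+) {l : List (Σ i, A i)}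
    (hl : IsReducedWord φ l) (hi : ∀ s ∈ l.head?, i ≠ s.1) :
    (replicaProj A i j - replicaProj A i ((j : ℕ) - 1)) * tensorWord l -
      (if j = l.length.succPNat then tensorWord l else 0) ∈ vacuumIdeal φ := by
  have hj : j = l.length.succPNat ↔ (j : ℕ) = l.length + 1 := by
    rw [← PNat.coe_inj, Nat.succPNat_coe]
  have hpos := j.pos
  rw [sub_mul]
  split_ifs with h <;> rw [hj] at h
  · rw [sub_right_comm]
    exact Submodule.sub_mem _ (replicaProj_mul_tensorWord_of_lt i (by omega))
      (replicaProj_mul_tensorWord_of_le i hl hi (by omega))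
  · rw [sub_zero]
    by_cases h1 : (j : ℕ) ≤ l.length
    · exact Submodule.sub_mem _ (replicaProj_mul_tensorWord_of_le i hl hi h1)
        (replicaProj_mul_tensorWord_of_le i hl hi (by omega))
    · rw [← sub_sub_sub_cancel_right _ _ (tensorWord l)]
      exact Submodule.sub_mem _ (replicaProj_mul_tensorWord_of_lt i (by omega))
        (replicaProj_mul_tensorWord_of_lt i (by omega))

theorem replicaProj_mul_atSite (i : I) (j : ℕ) (c : ℕ+) (x : BooleanExt (A i)) :
    replicaProj A i j * atSite i c x = atSite i c x * replicaProj A i j := by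
  rw [replicaProj]
  split_ifs with h
  · simp
  · rw [atSite_apply, PiTensorProduct.tprod_mul_tprod, PiTensorProduct.tprod_mul_tprod]
    congr 1
    ext s
    simp only [Pi.mul_apply]
    by_cases hs : s = (i, c)
    · subst hs; simp
    · rw [Pi.mulSingle_eq_of_ne hs, one_mul, mul_one]

/-- Common form of the two actions of a replica: `b = 1` creates a new leading letter, and `b` the
current leading letter of label `i` merges it with `a`. -/
theorem replica_mul_atSite_mul_tensorWord (i : I) (a : A i) (j c : ℕ+) (b : A i)
    {l : List (Σ i, A i)} (hl : IsReducedWord φ l) (hi : ∀ s ∈ l.head?, i ≠ s.1)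
    (hc : c = l.length.succPNat) :
    replica i a j * (atSite i c (ofAlg b) * tensorWord l) -
      (if j = c then atSite i c (ofAlg (a * b)) * tensorWord l else 0) ∈ vacuumIdeal φ := by
  subst hc
  have h1 := mul_mem_vacuumIdeal (atSite i j (ofAlg a) * atSite i l.length.succPNat (ofAlg b))
    (replicaProj_sub_mul_tensorWord i j hl hi)
  have h2 : replica i a j * (atSite i l.length.succPNat (ofAlg b) * tensorWord l) =
      atSite i j (ofAlg a) * atSite i l.length.succPNat (ofAlg b) *
        ((replicaProj A i j - replicaProj A i ((j : ℕ) - 1)) * tensorWord l) := by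
    rw [replica_eq, mul_assoc, mul_assoc, ← mul_assoc (replicaProj A i _ - _), sub_mul,
      replicaProj_mul_atSite, replicaProj_mul_atSite, ← mul_sub, mul_assoc]
  rw [mul_sub, ← h2] at h1
  convert h1 using 2
  split_ifs with h
  · rw [h, map_mul, map_mul]
  · rw [mul_zero]

theorem atSite_mul_tensorWord (i : I) (a : A i) (l : List (Σ i, A i)) :
    atSite i l.length.succPNat (ofAlg a) * tensorWord l =
      tensorWord (⟨i, a - φ i a • 1⟩ :: l) + φ i a • tensorWord l := by
  rw [tensorWord_cons]
  simp [sub_mul]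

theorem replica_mul_tensorWord (i : I) (a : A i) (j : ℕ+)
    {l : List (Σ i, A i)} (hl : IsReducedWord φ l) (hi : ∀ s ∈ l.head?, i ≠ s.1) :
    replica i a j * tensorWord l -
      (if j = l.length.succPNat then
        tensorWord (⟨i, a - φ i a • 1⟩ :: l) + φ i a • tensorWord l else 0) ∈ vacuumIdeal φ := by
  have h := replica_mul_atSite_mul_tensorWord i a j _ 1 hl hi rfl
  rwa [map_one, map_one, one_mul, mul_one, atSite_mul_tensorWord] at h

theorem replica_mul_tensorWord_cons (i : I) (a b : A i) (j : ℕ+)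
    {l : List (Σ i, A i)} (hl : IsReducedWord φ (⟨i, b⟩ :: l)) :
    replica i a j * tensorWord (⟨i, b⟩ :: l) -
      (if j = l.length.succPNat then
        tensorWord (⟨i, a * b - φ i (a * b) • 1⟩ :: l) + φ i (a * b) • tensorWord l else 0) ∈
      vacuumIdeal φ := by
  have h := replica_mul_atSite_mul_tensorWord i a j _ b hl.tail
    (fun s hs => (List.isChain_cons.mp hl.1).1 s hs) rfl
  rwa [atSite_mul_tensorWord (φ := φ) i (a * b), ← tensorWord_cons ⟨i, b⟩ l] at h

end TensorVectors

/-! ### Free moments as moments of sums of replicas. -/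

section FreeMoments

universe u v
variable {I : Type u} [DecidableEq I] {A : I → Type v} [∀ i, Ring (A i)] [∀ i, Algebra ℂ (A i)]
  {φ : ∀ i, NormalizedFunctional (A i)}

theorem freeWord_nil : freeWord ([] : List (Σ i, A i)) = 1 := by simp [freeWord]

theorem freeWord_cons (s : Σ i, A i) (l : List (Σ i, A i)) :
    freeWord (s :: l) = LinearAlgebra.FreeProduct.ι ℂ A s.1 s.2 * freeWord l := by simp [freeWord]

theorem freeWord_append (l l' : List (Σ i, A i)) :
    freeWord (l ++ l') = freeWord l * freeWord l' := by simp [freeWord]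

theorem freeWord_cons_center (i : I) (a : A i) (l : List (Σ i, A i)) :
    LinearAlgebra.FreeProduct.ι ℂ A i a * freeWord l =
      freeWord (⟨i, a - φ i a • 1⟩ :: l) + φ i a • freeWord l := by
  simp [freeWord_cons, sub_mul]

theorem center_apply (i : I) (a : A i) : φ i (a - φ i a • 1) = 0 := by simp [(φ i).map_one']

/-- The sum of the first `N` orthogonal replicas of a letter. -/
noncomputable def replicaSum (N : ℕ+) (s : Σ i, A i) : ReplicaTensor A :=
  ∑ j ∈ Finset.Icc 1 N, replica s.1 s.2 j

theorem sum_sub_ite_mem {M : Type*} [AddCommGroup M] [Module ℂ M] (V : Submodule ℂ M)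
    {f : ℕ+ → M} {x : M} {k N : ℕ+} (hk : k ≤ N)
    (h : ∀ j, f j - (if j = k then x else 0) ∈ V) : ∑ j ∈ Finset.Icc 1 N, f j - x ∈ V := by
  have hx : x = ∑ j ∈ Finset.Icc 1 N, if j = k then x else 0 := by
    rw [Finset.sum_ite_eq', if_pos (by simp [hk])]
  have h' : ∑ j ∈ Finset.Icc 1 N, f j - x =
      ∑ j ∈ Finset.Icc 1 N, (f j - if j = k then x else 0) := by
    rw [Finset.sum_sub_distrib, ← hx]
  rw [h']
  exact Submodule.sum_mem _ fun j _ => h j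

/-- The letters of `s` act from right to left, so the induction removes the last one while `l`
records the current word. Each action lengthens `l` by at most one, so the colors up to `N` suffice.
-/
theorem siteFunctional_prod_replicaSum_mul (N : ℕ+) (s l : List (Σ i, A i))
    (hl : IsReducedWord φ l) (hN : s.length + l.length ≤ N) :
    siteFunctional φ ((s.map (replicaSum N)).prod * tensorWord l) =
      freeProductFunctional φ (freeWord s * freeWord l) := by
  induction s using List.reverseRecOn generalizing l with
  | nil =>
    simp only [List.map_nil, List.prod_nil, one_mul, freeWord_nil]
    by_cases h : l = []
    · rw [h, tensorWord_nil, freeWord_nil, siteFunctional_one,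
        (freeProductFunctional_spec φ).map_one]
    · rw [siteFunctional_tensorWord hl h,
        (freeProductFunctional_spec φ).map_alternating l h hl.1 hl.2]
  | append_singleton s a ih =>
    obtain ⟨i, a⟩ := a
    have hk : l.length.succPNat ≤ N := by
      rw [← PNat.coe_le_coe, Nat.succPNat_coe]; simp at hN; omega
    have hsplit : (List.map (replicaSum N) (s ++ [⟨i, a⟩])).prod * tensorWord l =
        (s.map (replicaSum N)).prod * (replicaSum N ⟨i, a⟩ * tensorWord l) := by
      simp [mul_assoc]
    rw [hsplit, freeWord_append, mul_assoc]
    -- Both cases, a new letter or a merged one, amount to a letter `b` multiplying a word `l'` that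
    -- does not begin with `i`. Centering `b` splits both sides in the same way into two reduced
    -- words.
    have happly : ∀ (b : A i) (l' : List (Σ i, A i)), IsReducedWord φ l' →
        (∀ s ∈ l'.head?, i ≠ s.1) → l'.length ≤ l.length →
        freeWord [⟨i, a⟩] * freeWord l = LinearAlgebra.FreeProduct.ι ℂ A i b * freeWord l' →
        replicaSum N ⟨i, a⟩ * tensorWord l -
          (tensorWord (⟨i, b - φ i b • 1⟩ :: l') + φ i b • tensorWord l') ∈ vacuumIdeal φ →
        siteFunctional φ ((s.map (replicaSum N)).prod * (replicaSum N ⟨i, a⟩ * tensorWord l)) =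
          freeProductFunctional φ (freeWord s * (freeWord [⟨i, a⟩] * freeWord l)) := by
      intro b l' hl' hi hlen hfw hmem
      simp only [List.length_append, List.length_singleton] at hN
      rw [siteFunctional_mul_congr hmem, hfw, freeWord_cons_center (φ := φ), mul_add, mul_add,
        map_add, map_add, mul_smul_comm, mul_smul_comm, map_smul, map_smul,
        ih _ hl' (by omega), ih _ (hl'.cons (center_apply i b) hi) (by simp; omega)]
    by_cases hi : ∀ s ∈ l.head?, i ≠ s.1
    · refine happly a l hl hi le_rfl (by simp [freeWord]) ?_
      rw [replicaSum, Finset.sum_mul]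
      exact sum_sub_ite_mem _ hk fun j => replica_mul_tensorWord i a j hl hi
    · cases l with
      | nil => simp at hi
      | cons b l =>
        obtain ⟨i', b⟩ := b
        obtain rfl : i = i' := by simpa using hi
        refine happly (a * b) l hl.tail (List.isChain_cons.mp hl.1).1 (by simp)
          (by simp [freeWord, mul_assoc]) ?_
        rw [replicaSum, Finset.sum_mul]
        refine sum_sub_ite_mem _ (le_trans ?_ hk) fun j => replica_mul_tensorWord_cons i a b j hl
        rw [← PNat.coe_le_coe]; simp

/-- Free moments are moments of sums of orthogonal replicas. -/
theorem siteFunctional_prod_replicaSum (N : ℕ+) (s : List (Σ i, A i)) (hN : s.length ≤ N) :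
    siteFunctional φ (s.map (replicaSum N)).prod = freeProductFunctional φ (freeWord s) := by
  have h := siteFunctional_prod_replicaSum_mul (φ := φ) N s [] ⟨List.isChain_nil, by simp⟩
    (by simpa using hN)
  rwa [tensorWord_nil, freeWord_nil, mul_one, mul_one] at h

theorem unitIdentification_letter (i : I) (a : A i) :
    unitIdentification A (letter i a) = LinearAlgebra.FreeProduct.ι ℂ A i a := by
  have h := DFunLike.congr_fun (LinearAlgebra.FreeProduct.lift_comp_ι ℂ
    (fun i => Unitization ℂ (A i)) (fun {i} => Unitization.lift
      (LinearAlgebra.FreeProduct.ι ℂ A i : A i →ₙₐ[ℂ] LinearAlgebra.FreeProduct ℂ A)) (i := i))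
    (Unitization.inr a)
  rw [unitIdentification, letter]
  refine h.trans ?_
  rw [← Unitization.lift_symm_apply_apply, Equiv.symm_apply_apply]
  rfl

theorem unitIdentification_word {n : ℕ} {i : Fin n → I} (a : ∀ k, A (i k)) :
    unitIdentification A (word a) =
      freeWord (List.ofFn fun k => (⟨i k, a k⟩ : Σ i, A i)) := by
  rw [word, map_list_prod, freeWord, List.map_ofFn, List.map_ofFn]
  congr 2
  ext k
  simp [unitIdentification_letter]

theorem freeFunctional_word {n : ℕ} {i : Fin n → I} (a : ∀ k, A (i k)) :
    freeFunctional φ (word a) =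
      freeProductFunctional φ (freeWord (List.ofFn fun k => (⟨i k, a k⟩ : Σ i, A i))) := by
  rw [← unitIdentification_word]; rfl

/-! ### Expansion over colors: only reduced Motzkin words survive. -/

theorem prod_ofFn_sum {R κ : Type*} [Semiring R] {n : ℕ} (s : Finset κ)
    (f : Fin n → κ → R) :
    (List.ofFn fun k => ∑ j ∈ s, f k j).prod =
      ∑ w ∈ Fintype.piFinset (fun _ : Fin n => s), (List.ofFn fun k => f k (w k)).prod := by
  classical
  induction n with
  | zero => simp
  | succ n ih =>
    rw [List.ofFn_succ, List.prod_cons, ih, Finset.sum_mul_sum, ← Finset.sum_product']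
    refine Finset.sum_bij' (fun p _ => (Fin.cons p.1 p.2 : Fin (n + 1) → κ))
      (fun w _ => (w 0, Fin.tail w)) ?_ ?_ ?_ ?_ ?_
    · intro p hp
      simp only [Finset.mem_product, Fintype.mem_piFinset] at hp ⊢
      exact fun k => Fin.cases hp.1 hp.2 k
    · intro w hw
      simp only [Finset.mem_product, Fintype.mem_piFinset] at hw ⊢
      exact ⟨hw 0, fun k => hw k.succ⟩
    · intro p _; simp
    · intro w _; simp
    · intro p _; simp [List.ofFn_succ]

/-- A word in which the letter `(i, c)` is placed last: the words produced by the action of an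
orthogonal replica of label `i` and color `c`. -/
def EndsAt (i : I) (c : ℕ+) (l : List (Σ i, A i)) : Prop :=
  (l.length = c ∧ ∃ s ∈ l.head?, i = s.1) ∨ (l.length + 1 = c ∧ ∀ s ∈ l.head?, i ≠ s.1)

/-- The replica yields a combination of two words, one with and one without a letter at site `(i,
j)`. If the total is nonzero, one of them contributes, and it is passed on to the next replica to
the left. -/
theorem exists_endsAt_of_ne_zero {i : I} (a : A i) (j : ℕ+) {l : List (Σ i, A i)}
    (hl : IsReducedWord φ l) (y : ReplicaTensor A)
    (h : siteFunctional φ (y * (replica i a j * tensorWord l)) ≠ 0) :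
    EndsAt i j l ∧ ∃ l', IsReducedWord φ l' ∧ EndsAt i j l' ∧
      siteFunctional φ (y * tensorWord l') ≠ 0 := by
  have happly : ∀ (b : A i) (l' : List (Σ i, A i)), IsReducedWord φ l' →
      (∀ s ∈ l'.head?, i ≠ s.1) →
      replica i a j * tensorWord l - (if j = l'.length.succPNat then
        tensorWord (⟨i, b - φ i b • 1⟩ :: l') + φ i b • tensorWord l' else 0) ∈ vacuumIdeal φ →
      (j : ℕ) = l'.length + 1 ∧ ∃ l', IsReducedWord φ l' ∧ EndsAt i j l' ∧
        siteFunctional φ (y * tensorWord l') ≠ 0 := by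
    intro b l' hl' hi hmem
    rw [siteFunctional_mul_congr hmem] at h
    split_ifs at h with hj
    · have hj' : (j : ℕ) = l'.length + 1 := by rw [hj, Nat.succPNat_coe]
      refine ⟨hj', ?_⟩
      by_contra! hcon
      rw [mul_add, map_add, mul_smul_comm, map_smul, hcon l' hl' (Or.inr ⟨hj'.symm, hi⟩),
        hcon _ (hl'.cons (center_apply i b) hi) (Or.inl ⟨by simp [hj'], by simp⟩)] at h
      simp at h
    · simp at h
  by_cases hi : ∀ s ∈ l.head?, i ≠ s.1
  · obtain ⟨h1, h2⟩ := happly a l hl hi (replica_mul_tensorWord i a j hl hi)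
    exact ⟨Or.inr ⟨h1.symm, hi⟩, h2⟩
  · cases l with
    | nil => simp at hi
    | cons b l =>
      obtain ⟨i', b⟩ := b
      obtain rfl : i = i' := by simpa using hi
      obtain ⟨h1, h2⟩ := happly (a * b) l hl.tail (List.isChain_cons.mp hl.1).1
        (replica_mul_tensorWord_cons i a b j hl)
      exact ⟨Or.inl ⟨by simp [h1], by simp⟩, h2⟩

theorem EndsAt.color_sub_mem {i i' : I} {c c' : ℕ+} {l : List (Σ i, A i)} (h : EndsAt i c l)
    (h' : EndsAt i' c' l) : ((c : ℕ) : ℤ) - ((c' : ℕ) : ℤ) ∈ ({-1, 0, 1} : Set ℤ) := by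
  simp only [Set.mem_insert_iff, Set.mem_singleton_iff]
  rcases h with ⟨h, _⟩ | ⟨h, _⟩ <;> rcases h' with ⟨h', _⟩ | ⟨h', _⟩ <;> omega

/-- Here `c` is the color of the replica that has just acted, to the right of position `n`, and
produced `l`. The clause for `n = 0` is what later makes the leftmost color `1`. -/
theorem motzkin_of_ne_zero {n : ℕ} {i : Fin n → I} (a : ∀ k, A (i k))
    (w : Fin n → ℕ+) {i₀ : I} {c : ℕ+} {l : List (Σ i, A i)} (hl : IsReducedWord φ l)
    (hc : EndsAt i₀ c l)
    (h : siteFunctional φ ((List.ofFn fun k => replica (i k) (a k) (w k)).prod *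
      tensorWord l) ≠ 0) :
    (∀ k : Fin n, (k : ℕ) = 0 → w k = 1) ∧
    (∀ k : Fin n, (k : ℕ) + 1 = n →
      ((c : ℕ) : ℤ) - ((w k : ℕ) : ℤ) ∈ ({-1, 0, 1} : Set ℤ)) ∧
    (∀ k l : Fin n, (l : ℕ) = k + 1 →
      ((w l : ℕ) : ℤ) - ((w k : ℕ) : ℤ) ∈ ({-1, 0, 1} : Set ℤ)) ∧ (n = 0 → c = 1) := by
  induction n generalizing i₀ c l with
  | zero =>
    refine ⟨fun k => k.elim0, fun k => k.elim0, fun k => k.elim0, fun _ => ?_⟩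
    -- A nonempty reduced word has value `0`, so the process must end at the empty word, which
    -- forces the last acting color to be `1`.
    have hnil : l = [] := by
      by_contra hne
      apply h
      simpa using siteFunctional_tensorWord hl hne
    subst hnil
    rcases hc with ⟨h1, _⟩ | ⟨h1, _⟩
    · simp at h1; exact absurd h1.symm c.ne_zero
    · exact PNat.coe_inj.mp (by simpa using h1.symm)
  | succ n ih =>
    rw [List.ofFn_succ', List.concat_eq_append, List.prod_append, List.prod_singleton,
      mul_assoc] at h
    obtain ⟨h1, l', hl', hc', h'⟩ := exists_endsAt_of_ne_zero _ _ hl _ h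
    obtain ⟨m1, m2, m3, m4⟩ := ih (i := fun k => i k.castSucc)
      (fun k => a k.castSucc)
      (fun k => w k.castSucc) hl' hc' h'
    refine ⟨fun k => ?_, fun k hk => ?_, fun k l hkl => ?_, by simp⟩
    · refine Fin.lastCases (fun hk => m4 (by simpa using hk)) (fun k hk => m1 k (by simpa using hk)) k
    · obtain rfl : k = Fin.last n := Fin.ext (by simpa using hk)
      exact hc.color_sub_mem h1
    · obtain ⟨k, rfl⟩ : ∃ k' : Fin n, k = k'.castSucc :=
        ⟨⟨k, by have := l.2; omega⟩, rfl⟩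
      revert hkl
      refine Fin.lastCases (fun hk => m2 k (by simpa using hk.symm))
        (fun l hk => m3 k l (by simpa using hk)) l

theorem isReducedMotzkinWord_of_ne_zero {n : ℕ} {i : Fin n → I}
    (a : ∀ k, A (i k)) (w : Fin n → ℕ+) (h : motzkinFunctional φ w a ≠ 0) :
    IsReducedMotzkinWord w := by
  cases n with
  | zero => exact ⟨fun k => k.elim0, fun k => k.elim0, fun k => k.elim0⟩
  | succ n =>
    have hnil : IsReducedWord φ ([] : List (Σ i, A i)) := ⟨List.isChain_nil, by simp⟩
    change siteFunctional φ _ ≠ 0 at h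
    rw [List.ofFn_succ', List.concat_eq_append, List.prod_append, List.prod_singleton,
      ← mul_one (replica (i (Fin.last n)) _ _), ← tensorWord_nil] at h
    obtain ⟨h1, l', hl', hc', h'⟩ := exists_endsAt_of_ne_zero _ _ hnil _ h
    have hlast : w (Fin.last n) = 1 := by
      rcases h1 with ⟨_, h1⟩ | ⟨h1, _⟩
      · simp at h1
      · exact PNat.coe_inj.mp (by simpa using h1.symm)
    obtain ⟨m1, m2, m3, m4⟩ := motzkin_of_ne_zero (i := fun k : Fin n => i k.castSucc)
      (fun k => a k.castSucc)
      (fun k => w k.castSucc) hl' hc' h'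
    refine ⟨fun k => ?_, fun k hk => ?_, fun k l hkl => ?_⟩
    · refine Fin.lastCases (fun _ => hlast) (fun k hk => m1 k (by simpa using hk)) k
    · obtain rfl : k = Fin.last n := Fin.ext (by simpa using hk)
      exact hlast
    · obtain ⟨k, rfl⟩ : ∃ k' : Fin n, k = k'.castSucc :=
        ⟨⟨k, by have := l.2; omega⟩, rfl⟩
      revert hkl
      refine Fin.lastCases (fun hk => m2 k (by simpa using hk.symm))
        (fun l hk => m3 k l (by simpa using hk)) l

theorem freeFunctional_word_eq_sum_motzkinFunctional {n : ℕ} {i : Fin n → I}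
    (a : ∀ k, A (i k)) :
    freeFunctional φ (word a) = ∑ w ∈ motzkinWords n, motzkinFunctional φ w a := by
  -- Large enough both for the word length `n` and for every color occurring in a reduced Motzkin
  -- word of length `n`.
  set N : ℕ+ := (n + ∑ w ∈ motzkinWords n, ∑ k, (w k : ℕ)).succPNat with hN
  rw [freeFunctional_word, ← siteFunctional_prod_replicaSum N _ (by simp [hN]; omega),
    List.map_ofFn]
  simp only [Function.comp_def, replicaSum]
  rw [prod_ofFn_sum, map_sum]
  refine (Finset.sum_subset (fun w hw => ?_) fun w _ hw => ?_).symm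
  · rw [Fintype.mem_piFinset]
    intro k
    have h1 := Finset.single_le_sum (f := fun k => (w k : ℕ)) (fun _ _ => Nat.zero_le _)
      (Finset.mem_univ k)
    have h2 := Finset.single_le_sum (f := fun w : Fin n → ℕ+ => ∑ k, (w k : ℕ))
      (fun _ _ => Nat.zero_le _) hw
    rw [Finset.mem_Icc, ← PNat.coe_le_coe (w k), hN, Nat.succPNat_coe]
    exact ⟨one_le, by omega⟩
  · by_contra h
    refine hw ?_
    rw [motzkinWords, Set.Finite.mem_toFinset]
    exact isReducedMotzkinWord_of_ne_zero a w h

end FreeMoments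

/-! ### Differentiable curves in vector spaces without topology. -/

section DifferentiableCurves

/-- The curves in a vector space that are finite linear combinations of fixed vectors with
coefficients differentiable at `0`. -/
def diffCurves (V : Type*) [AddCommGroup V] [Module ℂ V] : Submodule ℂ (ℝ → V) :=
  Submodule.span ℂ {v | ∃ (c : ℝ → ℂ) (x : V), DifferentiableAt ℝ c 0 ∧ v = fun t => c t • x}

variable {V : Type*} [AddCommGroup V] [Module ℂ V]

theorem smul_mem_diffCurves {c : ℝ → ℂ} (hc : DifferentiableAt ℝ c 0) (x : V) :
    (fun t => c t • x) ∈ diffCurves V :=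
  Submodule.subset_span ⟨c, x, hc, rfl⟩

theorem const_mem_diffCurves (x : V) : (fun _ => x) ∈ diffCurves V := by
  simpa using smul_mem_diffCurves (differentiableAt_const (1 : ℂ)) x

theorem differentiableAt_of_mem_diffCurves {f : ℝ → V →ₗ[ℂ] ℂ}
    (hf : ∀ x, DifferentiableAt ℝ (fun t => f t x) 0) {v : ℝ → V} (hv : v ∈ diffCurves V) :
    DifferentiableAt ℝ (fun t => f t (v t)) 0 := by
  induction hv using Submodule.span_induction with
  | zero => simp
  | add v w _ _ hv hw => simpa using hv.fun_add hw
  | smul c v _ hv => simpa using hv.const_mul c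
  | mem v hv =>
    obtain ⟨c, x, hc, rfl⟩ := hv
    simpa using hc.fun_mul (hf x)

theorem map_mem_diffCurves {W : Type*} [AddCommGroup W] [Module ℂ W] (g : V →ₗ[ℂ] W)
    {v : ℝ → V} (hv : v ∈ diffCurves V) : (fun t => g (v t)) ∈ diffCurves W := by
  induction hv using Submodule.span_induction with
  | zero => simp only [Pi.zero_apply, map_zero]; exact (diffCurves W).zero_mem
  | add v w _ _ hv hw => simp only [Pi.add_apply, map_add]; exact (diffCurves W).add_mem hv hw
  | smul c v _ hv => simp only [Pi.smul_apply, map_smul]; exact (diffCurves W).smul_mem c hv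
  | mem v hv =>
    obtain ⟨c, x, hc, rfl⟩ := hv
    simpa using smul_mem_diffCurves hc (g x)

theorem smul_curve_mem_diffCurves {c : ℝ → ℂ} (hc : DifferentiableAt ℝ c 0)
    {v : ℝ → V} (hv : v ∈ diffCurves V) : (fun t => c t • v t) ∈ diffCurves V := by
  induction hv using Submodule.span_induction with
  | zero => simp only [Pi.zero_apply, smul_zero]; exact (diffCurves V).zero_mem
  | add v w _ _ hv hw => simp only [Pi.add_apply, smul_add]; exact (diffCurves V).add_mem hv hw
  | smul d v _ hv => simp only [Pi.smul_apply, smul_comm _ d]; exact (diffCurves V).smul_mem d hv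
  | mem v hv =>
    obtain ⟨d, x, hd, rfl⟩ := hv
    simpa [smul_smul] using smul_mem_diffCurves (hc.mul hd) x

end DifferentiableCurves

/-! ### Differentiability of Boolean, Motzkin and free moments in the parameter. -/

section Differentiability

universe u v

theorem booleanExt_induction {A : Type*} [Ring A] [Algebra ℂ A] {p : BooleanExt A → Prop}
    (alg : ∀ a, p (ofAlg a)) (idem : p idemP) (add : ∀ x y, p x → p y → p (x + y))
    (mul : ∀ x y, p x → p y → p (x * y)) (x : BooleanExt A) : p x := by
  obtain ⟨x, rfl⟩ : ∃ y, BooleanExt.mk A y = x := RingQuot.mkAlgHom_surjective ℂ _ x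
  induction x using FreeAlgebra.induction with
  | grade0 r =>
    rw [AlgHom.commutes, ← AlgHom.commutes ofAlg]
    exact alg _
  | grade1 x =>
    cases x with
    | none => exact idem
    | some a => exact alg a
  | mul x y hx hy => rw [map_mul]; exact mul _ _ hx hy
  | add x y hx hy => rw [map_add]; exact add _ _ hx hy

/-- Only `p` acts in a way that depends on `t`, and it returns a differentiable scalar times the
fixed vector `1`. -/
theorem booleanRep_mem_diffCurves {A : Type*} [Ring A] [Algebra ℂ A]
    {f : ℝ → NormalizedFunctional A} (hf : ∀ a, DifferentiableAt ℝ (fun t => f t a) 0)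
    (z : BooleanExt A) {v : ℝ → A} (hv : v ∈ diffCurves A) :
    (fun t => booleanRep (f t) z (v t)) ∈ diffCurves A := by
  induction z using booleanExt_induction generalizing v with
  | alg a =>
    simp only [booleanRep_ofAlg]
    exact map_mem_diffCurves (LinearMap.mulLeft ℂ a) hv
  | idem =>
    simp only [booleanRep_idemP]
    exact smul_mem_diffCurves (differentiableAt_of_mem_diffCurves hf hv) 1
  | add x y hx hy =>
    simp only [map_add, LinearMap.add_apply]
    exact (diffCurves A).add_mem (hx hv) (hy hv)
  | mul x y hx hy =>
    simp only [map_mul, Module.End.mul_apply]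
    exact hx (hy hv)

theorem differentiableAt_booleanExtFunctional {A : Type*} [Ring A] [Algebra ℂ A]
    {f : ℝ → NormalizedFunctional A} (hf : ∀ a, DifferentiableAt ℝ (fun t => f t a) 0)
    (z : BooleanExt A) : DifferentiableAt ℝ (fun t => booleanExtFunctional (f t) z) 0 :=
  differentiableAt_of_mem_diffCurves hf
    (booleanRep_mem_diffCurves hf z (const_mem_diffCurves 1))

theorem booleanExtFunctional_idemP_pow {A : Type*} [Ring A] [Algebra ℂ A]
    (φ : NormalizedFunctional A) (k : ℕ) : booleanExtFunctional φ (idemP ^ k) = 1 := by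
  induction k with
  | zero => simp [booleanExtFunctional, φ.map_one']
  | succ k ih => rw [pow_succ, booleanExtFunctional_mul_idemP, ih]

variable {I : Type u} [DecidableEq I] {A : I → Type v} [∀ i, Ring (A i)] [∀ i, Algebra ℂ (A i)]

variable (A) in
/-- The simple tensors all but finitely many of whose components are powers of the projections. -/
def localTensors : Submonoid (ReplicaTensor A) where
  carrier := {x | ∃ z : ∀ s : I × ℕ+, BooleanExt (A s.1),
    {s | z s ∉ Submonoid.powers idemP}.Finite ∧ PiTensorProduct.tprod ℂ z = x}
  one_mem' := ⟨1, by simp [one_mem], rfl⟩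
  mul_mem' := by
    rintro _ _ ⟨z, hz, rfl⟩ ⟨z', hz', rfl⟩
    refine ⟨z * z', (hz.union hz').subset fun s hs => ?_,
      (PiTensorProduct.tprod_mul_tprod z z').symm⟩
    by_contra hcon
    simp only [Set.mem_union, Set.mem_ofPred_eq, not_or, not_not] at hcon
    exact hs (mul_mem hcon.1 hcon.2)

theorem replica_mem_adjoin_localTensors (i : I) (a : A i) (j : ℕ+) :
    replica i a j ∈ Algebra.adjoin ℂ (localTensors A : Set (ReplicaTensor A)) := by
  have hP : ∀ j, replicaProj A i j ∈ Algebra.adjoin ℂ (localTensors A : Set (ReplicaTensor A)) := by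
    intro j
    rw [replicaProj]
    split_ifs
    · exact zero_mem _
    · refine Algebra.subset_adjoin ⟨_, ?_, rfl⟩
      convert Set.finite_empty
      refine Set.eq_empty_iff_forall_notMem.mpr fun s hs => hs ?_
      split_ifs
      exacts [Submonoid.mem_powers _, one_mem _]
  rw [replica_eq]
  refine mul_mem (Algebra.subset_adjoin ⟨_, ?_, rfl⟩) (sub_mem (hP _) (hP _))
  refine (Set.finite_singleton ((i, j) : I × ℕ+)).subset fun s hs => ?_
  by_contra hne
  refine hs ?_
  change Pi.mulSingle (M := fun s : I × ℕ+ => BooleanExt (A s.1)) _ _ s ∈ _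
  rw [Pi.mulSingle_eq_of_ne hne]
  exact one_mem _

/-- Powers of `p` have value `1` under every Boolean extension. On a local tensor the product over
sites thus runs over a finite set that does not depend on `t`, even when `p` occurs at infinitely
many sites. -/
theorem differentiableAt_siteFunctional {f : ℝ → ∀ i, NormalizedFunctional (A i)}
    (hf : ∀ i a, DifferentiableAt ℝ (fun t => f t i a) 0) {x : ReplicaTensor A}
    (hx : x ∈ Algebra.adjoin ℂ (localTensors A : Set (ReplicaTensor A))) :
    DifferentiableAt ℝ (fun t => siteFunctional (f t) x) 0 := by
  rw [← Subalgebra.mem_toSubmodule, Algebra.adjoin_eq_span, Submonoid.closure_eq] at hx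
  induction hx using Submodule.span_induction with
  | zero => simp
  | add v w _ _ hv hw => simpa using hv.fun_add hw
  | smul c v _ hv => simpa using hv.const_mul c
  | mem v hv =>
    obtain ⟨z, hz, rfl⟩ := hv
    have hone : ∀ t s, s ∉ hz.toFinset → booleanExtFunctional (f t s.1) (z s) = 1 := by
      intro t s hs
      simp only [Set.Finite.mem_toFinset, Set.mem_ofPred_eq, not_not] at hs
      obtain ⟨k, hk⟩ := hs
      rw [← hk]
      exact booleanExtFunctional_idemP_pow _ k
    have hprod : ∀ t, siteFunctional (f t) (PiTensorProduct.tprod ℂ z) =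
        ∏ s ∈ hz.toFinset, booleanExtFunctional (f t s.1) (z s) := by
      intro t
      have hsub : {s : I × ℕ+ | booleanExtFunctional (f t s.1) (z s) ≠ 1} ⊆ hz.toFinset :=
        fun s hs => by
          by_contra h
          exact hs (hone t s h)
      rw [siteFunctional, productFunctional_tprod _ _ ((Finset.finite_toSet _).subset hsub)]
      exact finprod_eq_prod_of_mulSupport_subset _ hsub
    simp only [hprod]
    exact DifferentiableAt.fun_finsetProd fun s _ =>
      differentiableAt_booleanExtFunctional (hf s.1) (z s)

theorem differentiableAt_motzkinFunctional {f : ℝ → ∀ i, NormalizedFunctional (A i)}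
    (hf : ∀ i a, DifferentiableAt ℝ (fun t => f t i a) 0) {n : ℕ} {i : Fin n → I}
    (w : Fin n → ℕ+) (a : ∀ k, A (i k)) :
    DifferentiableAt ℝ (fun t => motzkinFunctional (f t) w a) 0 := by
  refine differentiableAt_siteFunctional hf (Subalgebra.list_prod_mem _ ?_)
  simp only [List.forall_mem_ofFn_iff]
  exact fun k => replica_mem_adjoin_localTensors _ _ _

theorem mem_span_range_freeWord (x : LinearAlgebra.FreeProduct ℂ A) :
    x ∈ Submodule.span ℂ (Set.range (freeWord (A := A))) := by
  let M : Submonoid (LinearAlgebra.FreeProduct ℂ A) :=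
    { carrier := Set.range freeWord
      one_mem' := ⟨[], freeWord_nil⟩
      mul_mem' := by
        rintro _ _ ⟨l, rfl⟩ ⟨l', rfl⟩
        exact ⟨l ++ l', freeWord_append l l'⟩ }
  have hT : Algebra.adjoin ℂ (M : Set (LinearAlgebra.FreeProduct ℂ A)) = ⊤ :=
    freeProduct_subalgebra_eq_top _ fun i a =>
      Algebra.subset_adjoin ⟨[⟨i, a⟩], by simp [freeWord]⟩
  have hx : x ∈ Subalgebra.toSubmodule
      (Algebra.adjoin ℂ (M : Set (LinearAlgebra.FreeProduct ℂ A))) := by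
    rw [hT]; trivial
  rwa [Algebra.adjoin_eq_span, Submonoid.closure_eq] at hx

theorem differentiableAt_freeProductFunctional {f : ℝ → ∀ i, NormalizedFunctional (A i)}
    (hf : ∀ i a, DifferentiableAt ℝ (fun t => f t i a) 0) (x : LinearAlgebra.FreeProduct ℂ A) :
    DifferentiableAt ℝ (fun t => freeProductFunctional (f t) x) 0 := by
  induction mem_span_range_freeWord x using Submodule.span_induction with
  | zero => simp
  | add v w _ _ hv hw => simpa using hv.fun_add hw
  | smul c v _ hv => simpa using hv.const_mul c
  | mem v hv =>
    obtain ⟨l, rfl⟩ := hv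
    simp only [← siteFunctional_prod_replicaSum l.length.succPNat l (by simp)]
    refine differentiableAt_siteFunctional hf (Subalgebra.list_prod_mem _ fun y hy => ?_)
    obtain ⟨s, _, rfl⟩ := List.mem_map.mp hy
    exact Subalgebra.sum_mem _ fun j _ => replica_mem_adjoin_localTensors _ _ _

end Differentiability

/-! ### The derivative of a free moment in centered variables. -/

section InfinitesimalFreeness

universe u v
variable {I : Type u} [DecidableEq I] {A : I → Type v} [∀ i, Ring (A i)] [∀ i, Algebra ℂ (A i)]

/-- The centered letter `a - φ(a) 1`. -/
noncomputable def center (φ : ∀ i, NormalizedFunctional (A i)) (s : Σ i, A i) : Σ i, A i :=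
  ⟨s.1, s.2 - φ s.1 s.2 • 1⟩

theorem freeProductFunctional_map_center (φ : ∀ i, NormalizedFunctional (A i))
    {s : List (Σ i, A i)} (hs : s.IsChain (fun s s' => s.1 ≠ s'.1)) (h : s ≠ []) :
    freeProductFunctional φ (freeWord (s.map (center φ))) = 0 := by
  refine (freeProductFunctional_spec φ).map_alternating _ (by simpa using h) ?_ ?_
  · rw [List.isChain_map]
    exact hs
  · simp only [List.mem_map]
    rintro _ ⟨s, _, rfl⟩
    exact center_apply s.1 s.2

variable {f : ℝ → ∀ i, NormalizedFunctional (A i)} {d : ∀ i, A i → ℂ}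

/-- Telescoping over the letters: the prefix `x t` collects the letters already recentered at `t`,
while the rest are still the original ones. At `t = 0` recentering changes nothing, so `x 0` ends up
as the original prefix. -/
theorem hasDerivAt_freeProductFunctional_sub_center
    (hf : ∀ i a, HasDerivAt (fun t => f t i a) (d i a) 0) (s : List (Σ i, A i))
    (hs : ∀ a ∈ s, f 0 a.1 a.2 = 0) {x : ℝ → LinearAlgebra.FreeProduct ℂ A}
    (hx : x ∈ diffCurves (LinearAlgebra.FreeProduct ℂ A)) :
    HasDerivAt (fun t => freeProductFunctional (f t) (x t * freeWord s) -
        freeProductFunctional (f t) (x t * freeWord (s.map (center (f t)))))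
      (∑ k : Fin s.length, d (s.get k).1 (s.get k).2 *
        freeProductFunctional (f 0) (x 0 * freeWord (s.eraseIdx k))) 0 := by
  induction s generalizing x with
  | nil => simpa using hasDerivAt_const (0 : ℝ) (0 : ℂ)
  | cons a s ih =>
    obtain ⟨i, a⟩ := a
    have hfd : ∀ i a, DifferentiableAt ℝ (fun t => f t i a) 0 :=
      fun i a => (hf i a).differentiableAt
    have ha : f 0 i a = 0 := hs ⟨i, a⟩ (by simp)
    have hx' : (fun t => x t * LinearAlgebra.FreeProduct.ι ℂ A i (a - f t i a • 1)) ∈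
        diffCurves (LinearAlgebra.FreeProduct ℂ A) := by
      have h := (diffCurves (LinearAlgebra.FreeProduct ℂ A)).sub_mem
        (map_mem_diffCurves (LinearMap.mulRight ℂ (LinearAlgebra.FreeProduct.ι ℂ A i a)) hx)
        (smul_curve_mem_diffCurves (hfd i a) hx)
      convert h using 1
      ext t
      simp [mul_sub]
    -- Exchanging the first letter for its recentered version costs `f t i a` times the moment with
    -- that letter deleted. As `f 0 i a = 0`, the product rule keeps only the term with `d i a`.
    have h1 := (hf i a).fun_mul (differentiableAt_of_mem_diffCurves
      (differentiableAt_freeProductFunctional hfd)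
      (map_mem_diffCurves (LinearMap.mulRight ℂ (freeWord s)) hx)).hasDerivAt
    have h2 := h1.fun_add (ih (fun b hb => hs b (by simp [hb])) hx')
    refine HasDerivAt.congr_of_eventuallyEq (h2.congr_deriv ?_) (Filter.Eventually.of_forall
      fun t => ?_)
    · refine Eq.trans ?_ (Fin.sum_univ_succ (n := s.length) _).symm
      simp [ha, freeWord_cons, mul_assoc]
      exact Or.inl rfl
    · simp only [List.map_cons, freeWord_cons, center, LinearMap.mulRight_apply]
      simp only [map_sub, map_smul, map_one, mul_sub, sub_mul, mul_assoc, mul_smul_comm, one_mul,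
        smul_mul_assoc, smul_eq_mul]
      ring

variable {φ : ∀ i, NormalizedFunctional (A i)}

theorem freeProductFunctional_reverse_append_eq_zero {u v : List (Σ i, A i)}
    (hu : IsReducedWord φ u) (hv : IsReducedWord φ v)
    (huv : ∀ s ∈ u.head?, ∀ s' ∈ v.head?, s.1 ≠ s'.1) (h : u.reverse ++ v ≠ []) :
    freeProductFunctional φ (freeWord (u.reverse ++ v)) = 0 := by
  refine (freeProductFunctional_spec φ).map_alternating _ h ?_ ?_
  · rw [List.isChain_append, List.isChain_reverse, List.getLast?_reverse]
    exact ⟨hu.1.imp fun _ _ h => h.symm, hv.1, huv⟩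
  · intro s hs
    rcases List.mem_append.mp hs with hs | hs
    exacts [hu.2 s (List.mem_reverse.mp hs), hv.2 s hs]

/-- The covariance `φ (a b)` of two letters, `0` if their labels differ. -/
noncomputable def pairing (φ : ∀ i, NormalizedFunctional (A i)) (s s' : Σ i, A i) : ℂ :=
  if h : s'.1 = s.1 then φ s.1 (s.2 * relabel h s'.2) else 0

/-- At the junction, different labels leave an alternating centered word, of moment `0`. Equal
labels give `ab = (ab - φ(ab)1) + φ(ab)1`: the centered part again leaves an alternating word, and
the scalar part moves the junction outwards. -/
theorem freeProductFunctional_reverse_append {u v : List (Σ i, A i)}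
    (hu : IsReducedWord φ u) (hv : IsReducedWord φ v) :
    freeProductFunctional φ (freeWord (u.reverse ++ v)) =
      if u.length = v.length then (List.zipWith (pairing φ) u v).prod else 0 := by
  induction u generalizing v with
  | nil =>
    cases v with
    | nil => simp [freeWord_nil, (freeProductFunctional_spec φ).map_one]
    | cons b v =>
      rw [freeProductFunctional_reverse_append_eq_zero hu hv (by simp) (by simp), if_neg (by simp)]
  | cons a u ih =>
    cases v with
    | nil =>
      rw [freeProductFunctional_reverse_append_eq_zero hu hv (by simp) (by simp), if_neg (by simp)]
    | cons b v =>
      obtain ⟨i, a⟩ := a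
      obtain ⟨j, b⟩ := b
      by_cases h : j = i
      · subst h
        have h1 : freeWord (List.reverse (⟨j, a⟩ :: u) ++ ⟨j, b⟩ :: v) =
            freeWord (u.reverse ++ ⟨j, a * b - φ j (a * b) • 1⟩ :: v) +
              φ j (a * b) • freeWord (u.reverse ++ v) := by
          rw [freeWord_append u.reverse, freeWord_append u.reverse, ← mul_smul_comm, ← mul_add,
            ← freeWord_cons_center]
          simp [freeWord, mul_assoc]
        have hv' : IsReducedWord φ (⟨j, a * b - φ j (a * b) • 1⟩ :: v) :=
          hv.tail.cons (center_apply j (a * b)) (List.isChain_cons.mp hv.1).1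
        rw [h1, map_add, map_smul, ih hu.tail hv.tail,
          freeProductFunctional_reverse_append_eq_zero hu.tail hv' ?_ (by simp)]
        · simp [pairing, relabel]
        · intro s hs s' hs'
          have h2 := (List.isChain_cons.mp hu.1).1 s hs
          simp only [List.head?_cons, Option.mem_def, Option.some.injEq] at hs'
          subst hs'
          exact h2.symm
      · rw [freeProductFunctional_reverse_append_eq_zero hu hv (by simpa using Ne.symm h) (by simp)]
        simp [pairing, h]

theorem deriv_freeProductFunctional_freeWord
    (hf : ∀ i a, HasDerivAt (fun t => f t i a) (d i a) 0) {s : List (Σ i, A i)} (hne : s ≠ [])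
    (hs : IsReducedWord (f 0) s) :
    deriv (fun t => freeProductFunctional (f t) (freeWord s)) 0 =
      ∑ k : Fin s.length, d (s.get k).1 (s.get k).2 *
        if (k : ℕ) = s.length - (k + 1) then
          (List.zipWith (pairing (f 0)) (s.take k).reverse (s.drop (k + 1))).prod else 0 := by
  have h := hasDerivAt_freeProductFunctional_sub_center hf s hs.2 (const_mem_diffCurves 1)
  -- The fully recentered word has moment `0` for every `t`, so the telescoped difference is the
  -- moment itself.
  simp only [one_mul, freeProductFunctional_map_center _ hs.1 hne, sub_zero] at h
  rw [h.deriv]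
  refine Finset.sum_congr rfl fun k _ => ?_
  have hu : IsReducedWord (f 0) (s.take k).reverse :=
    ⟨List.isChain_reverse.mpr ((hs.1.take k).imp fun _ _ h => h.symm),
      fun a ha => hs.2 a (List.mem_of_mem_take (List.mem_reverse.mp ha))⟩
  have hv : IsReducedWord (f 0) (s.drop (k + 1)) :=
    ⟨hs.1.drop _, fun a ha => hs.2 a (List.mem_of_mem_drop ha)⟩
  have h1 := freeProductFunctional_reverse_append hu hv
  rw [List.reverse_reverse, ← List.eraseIdx_eq_take_drop_succ] at h1
  rw [h1]
  simp [k.2.le]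

theorem prod_zipWith_ofFn {α : Type*} (g : α → α → ℂ) {n m : ℕ} (h : n = 2 * m + 1)
    (S : Fin n → α) :
    (List.zipWith g ((List.ofFn S).take m).reverse ((List.ofFn S).drop (m + 1))).prod =
      ∏ k : Fin m, g (S (left h k)) (S (left h k).rev) := by
  have h1 : List.zipWith g ((List.ofFn S).take m).reverse ((List.ofFn S).drop (m + 1)) =
      List.ofFn fun k : Fin m => g (S (left h k.rev)) (S (left h k.rev).rev) := by
    refine List.ext_getElem (by simp; omega) fun k hk hk' => ?_
    simp only [List.length_ofFn] at hk'
    simp only [List.getElem_zipWith, List.getElem_reverse, List.getElem_take, List.getElem_drop,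
      List.getElem_ofFn, List.length_take, List.length_ofFn]
    congr 2 <;> ext <;> simp [left, Fin.val_rev] <;> omega
  rw [h1, List.prod_ofFn]
  -- The zipped lists run outwards from the middle, whereas the product is indexed from the outer
  -- ends inwards.
  exact Equiv.prod_comp Fin.revPerm fun k => g (S (left h k)) (S (left h k).rev)

theorem isReducedWord_ofFn {n : ℕ} {i : Fin n → I} (hi : Alternating i) (a : ∀ k, A (i k))
    (ha : ∀ k, φ (i k) (a k) = 0) :
    IsReducedWord φ (List.ofFn fun k => (⟨i k, a k⟩ : Σ i, A i)) := by
  constructor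
  · rw [List.isChain_iff_getElem]
    intro k hk
    simp only [List.getElem_ofFn]
    exact hi _ _ rfl
  · simp only [List.forall_mem_ofFn_iff]
    exact ha

variable {n : ℕ} {i : Fin n → I}

theorem deriv_freeFunctional_word_of_odd
    (hf : ∀ i a, HasDerivAt (fun t => f t i a) (d i a) 0) (hi : Alternating i) (a : ∀ k, A (i k))
    (ha : ∀ k, f 0 (i k) (a k) = 0) {m : ℕ} (h : n = 2 * m + 1) :
    deriv (fun t => freeFunctional (f t) (word a)) 0 =
      d (i (middle h)) (a (middle h)) * ∏ k : Fin m,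
        pairing (f 0) ⟨i (left h k), a (left h k)⟩ ⟨i (left h k).rev, a (left h k).rev⟩ := by
  simp only [freeFunctional_word]
  rw [deriv_freeProductFunctional_freeWord hf
    (by rw [ne_eq, List.ofFn_eq_nil_iff]; omega) (isReducedWord_ofFn hi a ha),
    Finset.sum_eq_single ⟨m, by simp; omega⟩]
  · have hget : (List.ofFn fun k => (⟨i k, a k⟩ : Σ i, A i)).get ⟨m, by simp; omega⟩ =
        ⟨i (middle h), a (middle h)⟩ := by simp [middle]
    rw [if_pos (by simp; omega), prod_zipWith_ofFn _ h, hget]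
  · intro k _ hk
    rw [if_neg, mul_zero]
    intro hk'
    apply hk
    ext
    simp only [List.length_ofFn] at hk' ⊢
    omega
  · simp

theorem deriv_freeFunctional_word_of_not_odd
    (hf : ∀ i a, HasDerivAt (fun t => f t i a) (d i a) 0) (hi : Alternating i) (a : ∀ k, A (i k))
    (ha : ∀ k, f 0 (i k) (a k) = 0) (hn : n ≠ 0) (h : ¬ Odd n) :
    deriv (fun t => freeFunctional (f t) (word a)) 0 = 0 := by
  simp only [freeFunctional_word]
  rw [deriv_freeProductFunctional_freeWord hf
    (by rw [ne_eq, List.ofFn_eq_nil_iff]; omega) (isReducedWord_ofFn hi a ha)]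
  refine Finset.sum_eq_zero fun k _ => ?_
  rw [if_neg, mul_zero]
  intro hk
  have hk2 := k.2
  simp only [List.length_ofFn] at hk hk2
  exact h ⟨k, by omega⟩

/-- A failure of symmetry can be moved to the left half and cannot occur at the middle position. The
corresponding pairing is then `0`. -/
theorem deriv_freeFunctional_word_of_not_symm
    (hf : ∀ i a, HasDerivAt (fun t => f t i a) (d i a) 0) (hi : Alternating i) (a : ∀ k, A (i k))
    (ha : ∀ k, f 0 (i k) (a k) = 0) (hn : Odd n) (h : ¬ ∀ k : Fin n, i k.rev = i k) :
    deriv (fun t => freeFunctional (f t) (word a)) 0 = 0 := by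
  obtain ⟨m, hm⟩ := hn
  rw [deriv_freeFunctional_word_of_odd hf hi a ha hm]
  obtain ⟨k, hk⟩ : ∃ k : Fin m, i (left hm k).rev ≠ i (left hm k) := by
    by_contra! hcon
    refine h fun k => ?_
    rcases lt_trichotomy (k : ℕ) m with hk | hk | hk
    · exact hcon ⟨k, hk⟩
    · congr 1
      ext
      rw [Fin.val_rev]
      omega
    · have h1 := hcon ⟨k.rev, by rw [Fin.val_rev]; omega⟩
      have h2 : left hm ⟨k.rev, by rw [Fin.val_rev]; omega⟩ = k.rev := rfl
      rw [h2, Fin.rev_rev] at h1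
      exact h1.symm
  rw [Finset.prod_eq_zero (Finset.mem_univ k) (by rw [pairing, dif_neg hk]), mul_zero]

end InfinitesimalFreeness

/-! ### Derivatives of the deformed functionals. -/

section DeformedFunctionals

universe u v
variable {I : Type u} {A : I → Type v} [∀ i, Ring (A i)] [∀ i, Algebra ℂ (A i)]
  {φ : ∀ i, NormalizedFunctional (A i)} (D : Deformation φ)

namespace Deformation

theorem state_eventuallyEq (i : I) (a : A i) :
    (fun t => D.state t i a) =ᶠ[𝓝 0] fun t => D.toLin t i a := by
  filter_upwards [Metric.ball_mem_nhds (0 : ℝ) D.ε_pos] with t ht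
  rw [state, dif_pos (by simpa using ht)]

theorem toLin_zero_apply (i : I) (a : A i) : D.toLin 0 i a = φ i a := by
  -- A remainder `o(t)` is bounded by `|t|` near `0`, hence vanishes at `t = 0` itself.
  have h := ((D.expansion i a).bound one_pos).self_of_nhds
  simpa [sub_eq_zero] using h

theorem state_zero : D.state 0 = φ := by
  funext i
  have h : (D.state 0 i).toLin = (φ i).toLin := by
    ext a
    exact (D.state_eventuallyEq i a).self_of_nhds.trans (D.toLin_zero_apply i a)
  cases h1 : D.state 0 i
  cases h2 : φ i
  simpa [h1, h2] using h

theorem hasDerivAt_state (i : I) (a : A i) :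
    HasDerivAt (fun t => D.state t i a) (D.der i a) 0 := by
  refine HasDerivAt.congr_of_eventuallyEq ?_ (D.state_eventuallyEq i a)
  rw [hasDerivAt_iff_isLittleO]
  refine (D.expansion i a).congr (fun t => ?_) fun t => (sub_zero t).symm
  rw [toLin_zero_apply, sub_zero, Complex.real_smul, sub_sub]

variable [DecidableEq I]

theorem differentiableAt_freeFunctionalAt (x : FreeProductWithoutUnits A) :
    DifferentiableAt ℝ (fun t => D.freeFunctionalAt t x) 0 :=
  differentiableAt_freeProductFunctional (fun i a => (D.hasDerivAt_state i a).differentiableAt) _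

theorem freeDerivative_letter (i : I) (a : A i) : D.freeDerivative (letter i a) = D.der i a := by
  rw [← (D.hasDerivAt_state i a).deriv, freeDerivative]
  congr 1
  ext t
  change freeProductFunctional _ (unitIdentification A (letter i a)) = _
  rw [unitIdentification_letter, (freeProductFunctional_spec _).map_ι]

end Deformation

theorem freeFunctional_letter_mul_letter [DecidableEq I] {i j : I} (h : j = i) (a : A i) (b : A j) :
    freeFunctional φ (letter i a * letter j b) = φ i (a * relabel h b) := by
  subst h
  change freeProductFunctional _ (unitIdentification A _) = _
  rw [map_mul, unitIdentification_letter, unitIdentification_letter, ← map_mul,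
    (freeProductFunctional_spec _).map_ι]
  rfl

end DeformedFunctionals

end MotzkinFree

theorem theorem7p1 {I : Type*} [DecidableEq I] {A : I → Type*} [∀ i, Ring (A i)]
    [∀ i, Algebra ℂ (A i)] (φ : ∀ i, NormalizedFunctional (A i)) (D : Deformation φ) :
    -- the derivative `φ'` exists on the whole free product
    (∀ x : FreeProductWithoutUnits A,
      DifferentiableAt ℝ (fun t : ℝ => D.freeFunctionalAt t x) 0) ∧
    ∀ (n : ℕ), 1 ≤ n → ∀ (i : Fin n → I), Alternating i → ∀ (a : ∀ k, A (i k)),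
      -- decomposition into infinitesimal Motzkin functionals
      ((∀ w ∈ motzkinWords n,
          DifferentiableAt ℝ (fun t : ℝ => D.motzkinFunctionalAt t w a) 0) ∧
        D.freeDerivative (word a) = ∑ w ∈ motzkinWords n, D.infinitesimalMotzkin w a) ∧
      -- centered variables
      ((∀ k, φ (i k) (a k) = 0) →
        (∀ (m : ℕ) (h : n = 2 * m + 1) (hsym : ∀ k : Fin n, i k.rev = i k),
          D.freeDerivative (word a) =
            D.der (i (middle h)) (a (middle h)) *
              ∏ k : Fin m, φ (i (left h k))
                (a (left h k) * relabel (hsym (left h k)) (a (left h k).rev))) ∧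
        (¬ (Odd n ∧ ∀ k : Fin n, i k.rev = i k) → D.freeDerivative (word a) = 0) ∧
        -- freeness for `φ`, and the formula in terms of the functionals `φ`, `φ'` alone
        freeFunctional φ (word a) = 0 ∧
        (∀ (m : ℕ) (h : n = 2 * m + 1), (∀ k : Fin n, i k.rev = i k) →
          D.freeDerivative (word a) =
            D.freeDerivative (letter (i (middle h)) (a (middle h))) *
              ∏ k : Fin m, freeFunctional φ
                (letter (i (left h k)) (a (left h k)) *
                  letter (i (left h k).rev) (a (left h k).rev)))) := by
  refine ⟨D.differentiableAt_freeFunctionalAt, fun n hn i hi a => ⟨?_, fun ha => ?_⟩⟩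
  · have hd : ∀ w : Fin n → ℕ+,
        DifferentiableAt ℝ (fun t : ℝ => D.motzkinFunctionalAt t w a) 0 := fun w =>
      differentiableAt_motzkinFunctional (fun i a => (D.hasDerivAt_state i a).differentiableAt) w a
    refine ⟨fun w _ => hd w, ?_⟩
    simp only [Deformation.freeDerivative, Deformation.freeFunctionalAt,
      Deformation.infinitesimalMotzkin]
    -- The index set of Motzkin words does not depend on `t`, so the derivative passes to the finite
    -- sum and the undifferentiated identity holds at each `t`.
    rw [← deriv_fun_sum fun w _ => hd w]
    simp only [freeFunctional_word_eq_sum_motzkinFunctional, Deformation.motzkinFunctionalAt]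
  · have ha0 : ∀ k, D.state 0 (i k) (a k) = 0 := by rwa [D.state_zero]
    have hmain : ∀ (m : ℕ) (h : n = 2 * m + 1) (hsym : ∀ k : Fin n, i k.rev = i k),
        D.freeDerivative (word a) = D.der (i (middle h)) (a (middle h)) *
          ∏ k : Fin m, φ (i (left h k))
            (a (left h k) * relabel (hsym (left h k)) (a (left h k).rev)) := by
      intro m h hsym
      refine (deriv_freeFunctional_word_of_odd D.hasDerivAt_state hi a ha0 h).trans ?_
      rw [D.state_zero]
      congr 1
      exact Finset.prod_congr rfl fun k _ => dif_pos (hsym (left h k))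
    refine ⟨hmain, fun h => ?_, ?_, fun m h hsym => ?_⟩
    · by_cases hodd : Odd n
      · exact deriv_freeFunctional_word_of_not_symm D.hasDerivAt_state hi a ha0 hodd
          fun hs => h ⟨hodd, hs⟩
      · exact deriv_freeFunctional_word_of_not_odd D.hasDerivAt_state hi a ha0 (by omega) hodd
    · have hr := isReducedWord_ofFn hi a ha
      rw [freeFunctional_word, (freeProductFunctional_spec φ).map_alternating _ ?_ hr.1 hr.2]
      rw [ne_eq, List.ofFn_eq_nil_iff]
      omega
    · rw [hmain m h hsym, D.freeDerivative_letter]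
      congr 1
      exact Finset.prod_congr rfl fun k _ =>
        (freeFunctional_letter_mul_letter (hsym (left h k)) _ _).symm
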